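/- Let $n\ge 1$, let $I=\{\varsigma_1,\dots,\varsigma_n\}$ be a set of $n$ symbols and let $S$ be a finite set of non-empty words over $I$ (symbols may be repeated in a word). For a word $s$ and $A\subseteq I$ write $s\subseteq A$ if every symbol of $s$ lies in $A$. For $N\ge n$ let $k(1,N),\dots,k(n,N)\ge 1$ be integers with $\sum_{i=1}^n k(i,N)=N$ and $k(i,N)/N\to p_i>0$ as $N\to\infty$. Write a configuration $\sigma\in\{+1,-1\}^N$ as $\sigma=(\sigma^1,\dots,\sigma^n)$ with consecutive blocks $\sigma^i\in\{+1,-1\}^{k(i,N)}$, let $\overline\sigma^i$ be the sum of the entries of $\sigma^i$, and for $s=\varsigma_{i_1}\cdots\varsigma_{i_l}\in S$ put $\sigma(s)=(\sigma^{i_1},\dots,\sigma^{i_l})$. For each $s\in S$ let $\lambda^s$ be a probability on $\mathbb R$ such that $0$ is an interior point of $\{\rho\in\mathbb R:\Lambda_s(\rho)<\infty\}$, where $\Lambda_s(\rho)=\log\int e^{\rho x}\,\lambda^s(dx)$; let $\lambda^s_N$ be the law of the mean of $N$ i.i.d. random variables with law $\lambda^s$, and let $\mathcal I_s(x)=\sup_{\rho\in\mathbb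 R}\{\rho x-\Lambda_s(\rho)\}$. Let $\mathcal I_0(y)=\frac{1+y}{2}\log(1+y)+\frac{1-y}{2}\log(1-y)$ for $|y|<1$, $\mathcal I_0(\pm1)=\log 2$, and $\mathcal I_0(y)=\infty$ for $|y|>1$. On a probability space let there be given, for every $N\ge n$, real random variables $\xi(s,\sigma(s))=\xi_N(s,\sigma(s))$, one for each $s\in S$ and each possible value of $\sigma(s)$, which are independent for each fixed $N$ (nothing is assumed about different $N$) and such that $\xi_N(s,\sigma(s))$ has law $\lambda^s_N$. For a sample point $\omega$ let $\mu_N(\omega)$ be the image of the uniform probability on $\{+1,-1\}^N$ under the map $$\sigma\mapsto\Big(\big(\xi(s,\sigma(s))(\omega)\big)_{s\in S},\ \big(\overline\sigma^i/N\big)_{1\le i\le n}\Big)\in\mathbb R^S\times\mathbb R^n .$$ Then for almost every $\omega$ the sequence $\{\mu_N(\omega),\,N\ge n\}$ satisfies the large deviation principle with rate function $\mathcal J$ given as follows: $\mathcal J(x,y)=\sum_{s\in S}\mathcal I_s(x_s)+\sum_{i=1}^n p_i\,\mathcal I_0(y_i/p_i)$ if $$\sum_{s\in S,\ s\subseteq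 A}\mathcal I_s(x_s)+\sum_{i:\,\varsigma_i\in A}p_i\,\mathcal I_0(y_i/p_i)\ \le\ \sum_{i:\,\varsigma_i\in A}p_i\log 2\qquad\text{for every }A\subseteq I,$$ and $\mathcal J(x,y)=\infty$ otherwise. That is, $\mathcal J:\mathbb R^S\times\mathbb R^n\to[0,\infty]$ is lower semicontinuous and, for every Borel set $B\subseteq\mathbb R^S\times\mathbb R^n$, $$-\inf_{B^\circ}\mathcal J\le\liminf_{N\to\infty}\tfrac1N\log\mu_N(\omega)(B)\le\limsup_{N\to\infty}\tfrac1N\log\mu_N(\omega)(B)\le-\inf_{\overline B}\mathcal J .$$ -/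

import Mathlib

open MeasureTheory ProbabilityTheory Filter Topology
open scoped ENNReal

namespace WordGREM

noncomputable section

/-! ### Large deviation principle -/

/-- The sequence `μ` of measures on `X` satisfies the large deviation principle, at speed `N`, with
rate function `I : X → [0, ∞]`. Logarithms are taken in `[-∞, ∞]`, with `log 0 = -∞`, and an
infimum over the empty set is `+∞`. -/
structure SatisfiesLDP {X : Type*} [TopologicalSpace X] [MeasurableSpace X]
    (μ : ℕ → Measure X) (I : X → ℝ≥0∞) : Prop where
  lowerSemicontinuous : LowerSemicontinuous I
  lower_bound : ∀ B : Set X, MeasurableSet B →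
    -(⨅ x ∈ interior B, (I x : EReal)) ≤
      liminf (fun N : ℕ => (((N : ℝ)⁻¹ : ℝ) : EReal) * ENNReal.log (μ N B)) atTop
  upper_bound : ∀ B : Set X, MeasurableSet B →
    limsup (fun N : ℕ => (((N : ℝ)⁻¹ : ℝ) : EReal) * ENNReal.log (μ N B)) atTop ≤
      -(⨅ x ∈ closure B, (I x : EReal))

/-! ### The driving laws and their rate functions -/

/-- The logarithmic moment generating function `ρ ↦ log E[exp (ρ X)] ∈ [-∞, ∞]` of a law on `ℝ`,
equal to `+∞` where the expectation is infinite. -/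
def logMGF (ν : Measure ℝ) (ρ : ℝ) : EReal :=
  ENNReal.log (∫⁻ x, ENNReal.ofReal (Real.exp (ρ * x)) ∂ν)

/-- The Fenchel–Legendre transform `sup_ρ (ρ x - log E[exp (ρ X)])`, with values in `[0, ∞]`. The
conversion to `[0, ∞]` changes nothing for a probability law, see `coe_cramerRate`. -/
def cramerRate (ν : Measure ℝ) (x : ℝ) : ℝ≥0∞ :=
  (⨆ ρ : ℝ, ((ρ * x : ℝ) : EReal) - logMGF ν ρ).toENNReal

theorem coe_cramerRate (ν : Measure ℝ) [IsProbabilityMeasure ν] (x : ℝ) :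
    (cramerRate ν x : EReal) = ⨆ ρ : ℝ, ((ρ * x : ℝ) : EReal) - logMGF ν ρ := by
  refine EReal.coe_toENNReal (le_iSup_of_le 0 ?_)
  simp [logMGF]

/-- The law of `(X₁ + ⋯ + X_N) / N` for i.i.d. `X₁, …, X_N` with law `ν`. -/
def sampleMeanLaw (ν : Measure ℝ) (N : ℕ) : Measure ℝ :=
  (Measure.pi fun _ : Fin N => ν).map fun x => (∑ j, x j) / N

/-- The rate function of the averages of i.i.d. symmetric `±1` variables:
`(1+y)/2 · log (1+y) + (1-y)/2 · log (1-y)` for `|y| ≤ 1` (which is `log 2` at `y = ±1`, because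
`0 · log 0 = 0`), and `∞` for `|y| > 1`. -/
def spinRate (y : ℝ) : ℝ≥0∞ :=
  if |y| ≤ 1 then
    ENNReal.ofReal ((1 + y) / 2 * Real.log (1 + y) + (1 - y) / 2 * Real.log (1 - y))
  else ⊤

/-! ### Configurations

The symbols are the elements of `Fin n`, and a word is a list of symbols. The sizes of the `n`
blocks of spins are given by `κ : Fin n → ℕ`, and a spin is an element of `ℤˣ = {1, -1}`. -/

variable {n : ℕ}

/-- Configurations `σ = (σ¹, …, σⁿ)` with `σⁱ ∈ {+1, -1}^(κ i)`. -/
abbrev Config (κ : Fin n → ℕ) : Type :=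
  (i : Fin n) → Fin (κ i) → ℤˣ

/-- The possible values of `σ(s)`: one block of spins for every symbol that occurs in `s`. (A symbol
that is repeated in `s` contributes the same block each time, so that there are
`2 ^ (∑ i with i ∈ s, κ i)` values.) -/
abbrev WordConfig (κ : Fin n → ℕ) (s : List (Fin n)) : Type :=
  (i : {i : Fin n // i ∈ s}) → Fin (κ i) → ℤˣ

/-- The restriction `σ(s)` of `σ` to the blocks that belong to the symbols of the word `s`. -/
def Config.onWord {κ : Fin n → ℕ} (σ : Config κ) (s : List (Fin n)) : WordConfig κ s :=
  fun i => σ i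

/-- The sum of the spins in the `i`-th block. -/
def Config.blockSum {κ : Fin n → ℕ} (σ : Config κ) (i : Fin n) : ℝ :=
  ∑ j, ((σ i j : ℤ) : ℝ)

/-! ### The joint empirical measure -/

/-- The point `((ξ(s, σ(s)))_s, (blockSum σ i / N)_i)` of `ℝ^S × ℝⁿ`, where `x s c` is the value of
the variable attached to the word `s` and to `c = σ(s)`. -/
def jointPoint (S : Finset (List (Fin n))) (N : ℕ) (κ : Fin n → ℕ)
    (x : (s : S) → WordConfig κ s → ℝ) (σ : Config κ) : (S → ℝ) × (Fin n → ℝ) :=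
  (fun s => x s (σ.onWord s), fun i => σ.blockSum i / N)

/-- The image of the uniform probability on configurations under `jointPoint`. -/
def empiricalMeasure (S : Finset (List (Fin n))) (N : ℕ) (κ : Fin n → ℕ)
    (x : (s : S) → WordConfig κ s → ℝ) : Measure ((S → ℝ) × (Fin n → ℝ)) :=
  (Fintype.card (Config κ) : ℝ≥0∞)⁻¹ • ∑ σ : Config κ, Measure.dirac (jointPoint S N κ x σ)

/-! ### The rate function -/

/-- The set of all `(x, y)` such that, for every set `A` of symbols,
`∑_{s ∈ S, s ⊆ A} I_s(x_s) + ∑_{i ∈ A} p_i I_0(y_i / p_i) ≤ ∑_{i ∈ A} p_i log 2`. -/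
def rateDomain (S : Finset (List (Fin n))) (p : Fin n → ℝ) (lam : S → Measure ℝ) :
    Set ((S → ℝ) × (Fin n → ℝ)) :=
  {z | ∀ A : Finset (Fin n),
    (∑ s : S with s.1.toFinset ⊆ A, cramerRate (lam s) (z.1 s)) +
        ∑ i ∈ A, ENNReal.ofReal (p i) * spinRate (z.2 i / p i) ≤
      ENNReal.ofReal (∑ i ∈ A, p i * Real.log 2)}

open Classical in
/-- The rate function: `∑_s I_s(x_s) + ∑_i p_i I_0(y_i / p_i)` on `rateDomain`, `∞` elsewhere. -/
def rate (S : Finset (List (Fin n))) (p : Fin n → ℝ) (lam : S → Measure ℝ)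
    (z : (S → ℝ) × (Fin n → ℝ)) : ℝ≥0∞ :=
  if z ∈ rateDomain S p lam then
    (∑ s : S, cramerRate (lam s) (z.1 s)) +
      ∑ i, ENNReal.ofReal (p i) * spinRate (z.2 i / p i)
  else ⊤

end

end WordGREM

namespace WordGREM

noncomputable section

/-! It suffices to prove a local principle (`LocalLDP`): an exponential upper bound on some
neighbourhood of each point, a lower bound on every neighbourhood, and exponential tightness. A
countable base and rational exponents make the exceptional null sets countable in number
(`ae_localLDP`), so the probabilistic work concerns one fixed box `∏ U s × ∏ V i`. Its empirical
mass is the fraction of configurations whose normalised block sums lie in the `V i` and whose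
variables lie in the `U s`.

The expectation of this fraction is a product of one-dimensional probabilities, and Cramér's theorem
(`cramer_upper`, `cramer_lower`) gives their exponents. It applies to the blocks as well, because
`spinRate` is the Cramér rate of a symmetric sign and `LocalLDP.rescale` passes from block size to
`N`. Markov's inequality then bounds the mass above. If the constraint for some `A` fails, the
expected number of partial configurations on the blocks of `A` that meet the conditions on these
blocks and on the words over `A` is exponentially small. By the union bound there is typically none,
and the mass of the box is zero (`measure_exists_wordEvent_le`, `empirical_upper`).

The lower bound is a second moment argument. Two configurations that agree exactly on the blocks of
`B` share exactly the variables of the words over `B`. Relative to the squared mean, such pairs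
contribute at most the inverse of the expected number of good partial configurations over `B`
(`sum_measure_wordEvent_inter_le`). When all constraints with `B` nonempty are strict, these
inverses are exponentially small, and Chebyshev's inequality keeps the mass above half its mean.
Strictness is obtained by moving the point slightly towards the means, where all rates vanish: by
convexity every rate shrinks by a factor `t < 1`, while the right-hand sides are positive and
unchanged (`empirical_lower`).

All almost sure statements come from the first Borel–Cantelli lemma, so no relation between
different `N` is needed. -/

/-! ### Exponential scales -/

/-- The number `exp (-N a)`, as an extended nonnegative real. -/
def expScale (a : ℝ) (N : ℕ) : ℝ≥0∞ :=
  ENNReal.ofReal (Real.exp (-(N * a)))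

theorem expScale_pos (a : ℝ) (N : ℕ) : 0 < expScale a N := by
  simp [expScale, Real.exp_pos]

theorem expScale_ne_top (a : ℝ) (N : ℕ) : expScale a N ≠ ⊤ := ENNReal.ofReal_ne_top

theorem expScale_mul (a b : ℝ) (N : ℕ) :
    expScale a N * expScale b N = expScale (a + b) N := by
  rw [expScale, expScale, expScale, ← ENNReal.ofReal_mul (Real.exp_pos _).le, ← Real.exp_add]
  congr 2
  ring

theorem expScale_inv (a : ℝ) (N : ℕ) : (expScale a N)⁻¹ = expScale (-a) N := by
  rw [expScale, expScale, ← ENNReal.ofReal_inv_of_pos (Real.exp_pos _), ← Real.exp_neg]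
  congr 2
  ring

theorem expScale_zero (N : ℕ) : expScale 0 N = 1 := by simp [expScale]

theorem prod_expScale {ι : Type*} (s : Finset ι) (a : ι → ℝ) (N : ℕ) :
    ∏ i ∈ s, expScale (a i) N = expScale (∑ i ∈ s, a i) N := by
  classical
  induction s using Finset.induction_on with
  | empty => simp [expScale_zero]
  | insert i s hi ih => rw [Finset.prod_insert hi, Finset.sum_insert hi, ih, expScale_mul]

theorem expScale_anti {a b : ℝ} (h : a ≤ b) (N : ℕ) : expScale b N ≤ expScale a N := by
  unfold expScale
  gcongr

theorem log_expScale (a : ℝ) (N : ℕ) : ENNReal.log (expScale a N) = ((-(N * a) : ℝ) : EReal) := by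
  rw [expScale, ENNReal.log_ofReal_of_pos (Real.exp_pos _), Real.log_exp]

theorem tsum_expScale_ne_top {a : ℝ} (ha : 0 < a) : ∑' N, expScale a N ≠ ⊤ := by
  have h : ∀ N, expScale a N = ENNReal.ofReal (Real.exp (-a)) ^ N := by
    intro N
    rw [expScale, ← ENNReal.ofReal_pow (Real.exp_pos _).le, ← Real.exp_nat_mul]
    congr 2
    ring
  simp_rw [h]
  rw [ENNReal.tsum_geometric]
  have : ENNReal.ofReal (Real.exp (-a)) < 1 := by
    rw [ENNReal.ofReal_lt_one]
    simpa using ha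
  simpa [tsub_eq_zero_iff_le] using this

/-- A strict loss in the exponent absorbs any constant factor; this removes the constants of union
bounds and of Chebyshev's inequality. -/
theorem eventually_mul_expScale_le {a b : ℝ} (h : a < b) {C : ℝ≥0∞} (hC : C ≠ ⊤) :
    ∀ᶠ N in atTop, C * expScale b N ≤ expScale a N := by
  have h1 : Tendsto (fun N : ℕ => Real.exp (N * (b - a))) atTop atTop :=
    Real.tendsto_exp_atTop.comp
      (tendsto_natCast_atTop_atTop.atTop_mul_const (sub_pos.2 h))
  filter_upwards [h1.eventually_ge_atTop C.toReal] with N hN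
  have h2 : C ≤ expScale (a - b) N := by
    rw [← ENNReal.ofReal_toReal hC, expScale]
    refine ENNReal.ofReal_le_ofReal (hN.trans_eq ?_)
    congr 1
    ring
  calc C * expScale b N ≤ expScale (a - b) N * expScale b N := by gcongr
    _ = expScale a N := by rw [expScale_mul]; congr 1; ring

theorem log_scaled_le {m : ℝ≥0∞} {a : ℝ} {N : ℕ} (hN : 0 < N) (h : m ≤ expScale a N) :
    (((N : ℝ)⁻¹ : ℝ) : EReal) * ENNReal.log m ≤ ((-a : ℝ) : EReal) := by
  have h0 : (0 : EReal) ≤ (((N : ℝ)⁻¹ : ℝ) : EReal) := by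
    exact_mod_cast (by positivity : (0 : ℝ) ≤ (N : ℝ)⁻¹)
  refine (mul_le_mul_of_nonneg_left (ENNReal.log_le_log h) h0).trans_eq ?_
  rw [log_expScale, ← EReal.coe_mul]
  congr 1
  field_simp

theorem le_log_scaled {m : ℝ≥0∞} {a : ℝ} {N : ℕ} (hN : 0 < N) (h : expScale a N ≤ m) :
    ((-a : ℝ) : EReal) ≤ (((N : ℝ)⁻¹ : ℝ) : EReal) * ENNReal.log m := by
  have h0 : (0 : EReal) ≤ (((N : ℝ)⁻¹ : ℝ) : EReal) := by
    exact_mod_cast (by positivity : (0 : ℝ) ≤ (N : ℝ)⁻¹)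
  refine Eq.trans_le ?_ (mul_le_mul_of_nonneg_left (ENNReal.log_le_log h) h0)
  rw [log_expScale, ← EReal.coe_mul]
  congr 1
  field_simp

/-! ### Local form of the large deviation principle -/

/-- Exponential tightness together with the large deviation bounds for small neighbourhoods of
points. -/
structure LocalLDP {X : Type*} [TopologicalSpace X] [MeasurableSpace X]
    (ν : ℕ → Measure X) (I : X → ℝ≥0∞) : Prop where
  lowerSemicontinuous : LowerSemicontinuous I
  upper : ∀ x, ∀ a : ℝ, (a : EReal) < I x →
    ∃ U, IsOpen U ∧ x ∈ U ∧ ∀ᶠ N in atTop, ν N U ≤ expScale a N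
  lower : ∀ x, ∀ a : ℝ, (I x : EReal) < a → ∀ U, IsOpen U → x ∈ U →
    ∀ᶠ N in atTop, expScale a N ≤ ν N U
  tight : ∀ a : ℝ, ∃ K, IsCompact K ∧ ∀ᶠ N in atTop, ν N Kᶜ ≤ expScale a N

/-- For the upper bound, tightness reduces `B` to a compact set, which finitely many of the local
neighbourhoods cover; their number only enters as a constant. The lower bound needs just one
neighbourhood, `interior B`, of each of its points. -/
theorem LocalLDP.satisfiesLDP {X : Type*} [TopologicalSpace X] [MeasurableSpace X]
    {ν : ℕ → Measure X} {I : X → ℝ≥0∞} (h : LocalLDP ν I) : SatisfiesLDP ν I where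
  lowerSemicontinuous := h.lowerSemicontinuous
  lower_bound B _ := by
    refine EReal.neg_le_of_neg_le (le_iInf₂ fun x hx => ?_)
    refine EReal.neg_le_of_neg_le ?_
    refine EReal.ge_of_forall_gt_iff_ge.1 fun b hb => ?_
    have hb' : (I x : EReal) < ((-b : ℝ) : EReal) := by
      rw [EReal.coe_neg]
      exact EReal.lt_neg_comm.1 hb
    refine le_liminf_of_le (by isBoundedDefault) ?_
    filter_upwards [h.lower x (-b) hb' _ isOpen_interior hx, eventually_gt_atTop 0] with N hN hN0
    simpa using le_log_scaled hN0 (hN.trans (measure_mono interior_subset))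
  upper_bound B _ := by
    refine EReal.le_neg_of_le_neg ?_
    refine EReal.ge_of_forall_gt_iff_ge.1 fun a ha => ?_
    obtain ⟨a', haa', ha'⟩ := EReal.lt_iff_exists_real_btwn.1 ha
    have haa : a < a' := by exact_mod_cast haa'
    obtain ⟨K, hK, hKN⟩ := h.tight a'
    have hloc : ∀ x ∈ K ∩ closure B, ∃ U, IsOpen U ∧ x ∈ U ∧
        ∀ᶠ N in atTop, ν N U ≤ expScale a' N := fun x hx =>
      h.upper x a' (ha'.trans_le (iInf₂_le x hx.2))
    have hcov : ∃ V : Set X, K ∩ closure B ⊆ V ∧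
        ∃ C : ℝ≥0∞, C ≠ ⊤ ∧ ∀ᶠ N in atTop, ν N V ≤ C * expScale a' N := by
      refine (hK.inter_right isClosed_closure).induction_on
        (p := fun s => ∃ V : Set X, s ⊆ V ∧
          ∃ C : ℝ≥0∞, C ≠ ⊤ ∧ ∀ᶠ N in atTop, ν N V ≤ C * expScale a' N) ?_ ?_ ?_ ?_
      · exact ⟨∅, subset_rfl, 0, by simp, by simp⟩
      · rintro s t hst ⟨V, hV, H⟩
        exact ⟨V, hst.trans hV, H⟩
      · rintro s t ⟨V, hV, C, hC, H⟩ ⟨W, hW, D, hD, H'⟩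
        refine ⟨V ∪ W, Set.union_subset_union hV hW, C + D, ENNReal.add_ne_top.2 ⟨hC, hD⟩, ?_⟩
        filter_upwards [H, H'] with N h1 h2
        rw [add_mul]
        exact (measure_union_le _ _).trans (add_le_add h1 h2)
      · intro x hx
        obtain ⟨U, hU, hxU, H⟩ := hloc x hx
        exact ⟨U, mem_nhdsWithin_of_mem_nhds (hU.mem_nhds hxU), U, subset_rfl, 1, by simp,
          by simpa using H⟩
    obtain ⟨V, hV, C, hC, H⟩ := hcov
    refine EReal.le_neg_of_le_neg ?_
    refine limsup_le_of_le (by isBoundedDefault) ?_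
    filter_upwards [H, hKN, eventually_gt_atTop 0,
      eventually_mul_expScale_le haa (ENNReal.add_ne_top.2 ⟨hC, ENNReal.one_ne_top⟩)]
      with N h1 h2 h3 h4
    rw [← EReal.coe_neg]
    refine log_scaled_le h3 (le_trans ?_ h4)
    have hB : B ⊆ V ∪ Kᶜ := by
      intro x hx
      by_cases hxK : x ∈ K
      · exact Or.inl (hV ⟨hxK, subset_closure hx⟩)
      · exact Or.inr hxK
    rw [add_mul, one_mul]
    exact (measure_mono hB).trans ((measure_union_le _ _).trans (add_le_add h1 h2))

/-! ### Product measures -/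

theorem lintegral_pi_prod (ν : Measure ℝ) [IsProbabilityMeasure ν] {N : ℕ}
    {g : Fin N → ℝ → ℝ≥0∞} (hg : ∀ j, Measurable (g j)) :
    ∫⁻ x, ∏ j, g j (x j) ∂(Measure.pi fun _ : Fin N => ν) = ∏ j, ∫⁻ y, g j y ∂ν := by
  refine (lintegral_prod_eq_prod_lintegral_of_indepFun Finset.univ
    (fun j (x : Fin N → ℝ) => g j (x j))
    (iIndepFun_pi (μ := fun _ : Fin N => ν) fun j => (hg j).aemeasurable)
    fun j => (hg j).comp (measurable_pi_apply j)).trans ?_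
  refine Finset.prod_congr rfl fun j _ => ?_
  exact (measurePreserving_eval (fun _ : Fin N => ν) j).lintegral_comp (hg j)

/-- This is the change of measure for the tilting argument: the density of the tilted sample
factorises over its coordinates. -/
theorem pi_withDensity (ν : Measure ℝ) [IsProbabilityMeasure ν] {g : ℝ → ℝ≥0∞}
    (hg : Measurable g) [IsProbabilityMeasure (ν.withDensity g)] (N : ℕ) :
    (Measure.pi fun _ : Fin N => ν.withDensity g) =
      (Measure.pi fun _ : Fin N => ν).withDensity fun x => ∏ j, g (x j) := by
  refine Measure.pi_eq fun s hs => ?_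
  rw [withDensity_apply _ (MeasurableSet.univ_pi hs),
    ← lintegral_indicator (MeasurableSet.univ_pi hs)]
  have h : ∀ x : Fin N → ℝ, (Set.univ.pi s).indicator (fun x => ∏ j, g (x j)) x =
      ∏ j, (s j).indicator g (x j) := by
    intro x
    by_cases hx : x ∈ Set.univ.pi s
    · rw [Set.indicator_of_mem hx]
      exact Finset.prod_congr rfl fun j _ => (Set.indicator_of_mem (hx j trivial) g).symm
    · rw [Set.indicator_of_notMem hx]
      obtain ⟨j, hj⟩ : ∃ j, x j ∉ s j := by simpa using hx
      exact (Finset.prod_eq_zero (Finset.mem_univ j) (Set.indicator_of_notMem hj g)).symm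
  simp_rw [h]
  rw [lintegral_pi_prod ν fun j => hg.indicator (hs j)]
  exact Finset.prod_congr rfl fun j _ => by
    rw [lintegral_indicator (hs j), withDensity_apply _ (hs j)]

theorem sampleMeanLaw_apply (ν : Measure ℝ) (N : ℕ) {U : Set ℝ} (hU : MeasurableSet U) :
    sampleMeanLaw ν N U =
      (Measure.pi fun _ : Fin N => ν) {x | (∑ j, x j) / N ∈ U} := by
  rw [sampleMeanLaw, Measure.map_apply (by fun_prop) hU]
  rfl

/-! ### Exponential moments and the upper bound -/

/-- The moment generating function of `ν` centred at `x`, with values in `[0, ∞]`. -/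
def laplace (ν : Measure ℝ) (x ρ : ℝ) : ℝ≥0∞ :=
  ∫⁻ y, ENNReal.ofReal (Real.exp (ρ * (y - x))) ∂ν

theorem logMGF_eq (ν : Measure ℝ) (ρ : ℝ) : logMGF ν ρ = ENNReal.log (laplace ν 0 ρ) := by
  simp [logMGF, laplace]

theorem laplace_ne_zero (ν : Measure ℝ) [NeZero ν] (x ρ : ℝ) : laplace ν x ρ ≠ 0 := by
  rw [laplace, Ne, lintegral_eq_zero_iff (by fun_prop)]
  intro h
  obtain ⟨y, hy⟩ := h.exists
  simp only [Pi.zero_apply, ENNReal.ofReal_eq_zero] at hy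
  exact absurd hy (not_le.2 (Real.exp_pos _))

theorem laplace_eq_mul (ν : Measure ℝ) (x ρ : ℝ) :
    laplace ν x ρ = ENNReal.ofReal (Real.exp (-(ρ * x))) * laplace ν 0 ρ := by
  rw [laplace, laplace, ← lintegral_const_mul _ (by fun_prop)]
  refine lintegral_congr fun y => ?_
  rw [← ENNReal.ofReal_mul (Real.exp_pos _).le, ← Real.exp_add]
  congr 2
  ring

/-- Exponential Chebyshev inequality: on the event, `exp (ρ ∑ x j)` is at least `exp (N (L + a))`,
and its expectation is at most `exp (N L)` by independence. -/
theorem sampleMeanLaw_le_expScale (ν : Measure ℝ) [IsProbabilityMeasure ν] {ρ L a : ℝ}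
    (hL : laplace ν 0 ρ ≤ ENNReal.ofReal (Real.exp L)) {U : Set ℝ} (hU : MeasurableSet U)
    (h : ∀ x ∈ U, a ≤ ρ * x - L) {N : ℕ} (hN : 0 < N) :
    sampleMeanLaw ν N U ≤ expScale a N := by
  rw [sampleMeanLaw_apply ν N hU]
  have hE : MeasurableSet {x : Fin N → ℝ | (∑ j, x j) / N ∈ U} := by
    have : Measurable fun x : Fin N → ℝ => (∑ j, x j) / N := by fun_prop
    exact this hU
  have hN' : (0 : ℝ) < N := by exact_mod_cast hN
  calc (Measure.pi fun _ : Fin N => ν) {x | (∑ j, x j) / N ∈ U}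
      = ∫⁻ x in {x : Fin N → ℝ | (∑ j, x j) / N ∈ U}, 1 ∂(Measure.pi fun _ : Fin N => ν) := by
        simp
    _ ≤ ∫⁻ x in {x : Fin N → ℝ | (∑ j, x j) / N ∈ U}, expScale (L + a) N *
          ∏ j, ENNReal.ofReal (Real.exp (ρ * (x j - 0))) ∂(Measure.pi fun _ : Fin N => ν) := by
        refine setLIntegral_mono (by fun_prop) fun x hx => ?_
        have h1 := h _ hx
        have h2 : (N : ℝ) * (L + a) ≤ ρ * ∑ j, x j := by
          have : ρ * ∑ j, x j = N * (ρ * ((∑ j, x j) / N)) := by field_simp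
          rw [this]
          gcongr
          linarith
        rw [← ENNReal.ofReal_prod_of_nonneg fun _ _ => (Real.exp_pos _).le, ← Real.exp_sum,
          expScale, ← ENNReal.ofReal_mul (Real.exp_pos _).le, ← Real.exp_add,
          ENNReal.one_le_ofReal, Real.one_le_exp_iff]
        simp only [sub_zero, ← Finset.mul_sum]
        linarith
    _ ≤ ∫⁻ x, expScale (L + a) N *
          ∏ j, ENNReal.ofReal (Real.exp (ρ * (x j - 0))) ∂(Measure.pi fun _ : Fin N => ν) :=
        setLIntegral_le_lintegral _ _
    _ = expScale (L + a) N * laplace ν 0 ρ ^ N := by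
        rw [lintegral_const_mul _ (by fun_prop), lintegral_pi_prod ν
          (g := fun _ y => ENNReal.ofReal (Real.exp (ρ * (y - 0)))) fun _ => by fun_prop]
        simp [laplace]
    _ ≤ expScale (L + a) N * ENNReal.ofReal (Real.exp L) ^ N := by gcongr
    _ = expScale a N := by
        rw [← ENNReal.ofReal_pow (Real.exp_pos _).le, ← Real.exp_nat_mul, expScale,
          ← ENNReal.ofReal_mul (Real.exp_pos _).le, ← Real.exp_add, expScale]
        congr 2
        ring

/-! ### The rate function of Cramér's theorem -/

/-- Only those `ρ` with a finite exponential moment matter in the supremum, and for them the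
logarithm is a real number `L`. A single pair `(ρ, L)` then witnesses the bound on a whole
neighbourhood, which yields lower semicontinuity and the upper bound. -/
theorem lt_cramerRate_iff (ν : Measure ℝ) [IsProbabilityMeasure ν] {x a : ℝ} :
    (a : EReal) < cramerRate ν x ↔
      ∃ ρ L : ℝ, laplace ν 0 ρ = ENNReal.ofReal (Real.exp L) ∧ a < ρ * x - L := by
  rw [coe_cramerRate, lt_iSup_iff]
  constructor
  · rintro ⟨ρ, h⟩
    rw [logMGF_eq] at h
    have htop : laplace ν 0 ρ ≠ ⊤ := by
      intro h'
      simp [h'] at h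
    have hpos : 0 < (laplace ν 0 ρ).toReal := ENNReal.toReal_pos (laplace_ne_zero ν 0 ρ) htop
    refine ⟨ρ, Real.log (laplace ν 0 ρ).toReal, ?_, ?_⟩
    · rw [Real.exp_log hpos, ENNReal.ofReal_toReal htop]
    · rw [← ENNReal.ofReal_toReal htop, ENNReal.log_ofReal_of_pos hpos] at h
      exact_mod_cast h
  · rintro ⟨ρ, L, h, h'⟩
    refine ⟨ρ, ?_⟩
    rw [logMGF_eq, h, ENNReal.log_ofReal_of_pos (Real.exp_pos _), Real.log_exp]
    exact_mod_cast h'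

theorem cramerRate_le_iff (ν : Measure ℝ) [IsProbabilityMeasure ν] {x a : ℝ} :
    (cramerRate ν x : EReal) ≤ a ↔
      ∀ ρ L : ℝ, laplace ν 0 ρ = ENNReal.ofReal (Real.exp L) → ρ * x - L ≤ a := by
  rw [← not_lt, lt_cramerRate_iff]
  push Not
  rfl

theorem lowerSemicontinuous_cramerRate (ν : Measure ℝ) [IsProbabilityMeasure ν] :
    LowerSemicontinuous (cramerRate ν) := by
  intro x b hb
  obtain ⟨a, hba, hax⟩ := EReal.lt_iff_exists_real_btwn.1 (EReal.coe_ennreal_lt_coe_ennreal_iff.2 hb)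
  obtain ⟨ρ, L, hL, h⟩ := (lt_cramerRate_iff ν).1 hax
  have : ∀ᶠ y in 𝓝 x, a < ρ * y - L :=
    (by fun_prop : Continuous fun y : ℝ => ρ * y - L).continuousAt.eventually_const_lt h
  filter_upwards [this] with y hy
  exact EReal.coe_ennreal_lt_coe_ennreal_iff.1
    (hba.trans ((lt_cramerRate_iff ν).2 ⟨ρ, L, hL, hy⟩))

theorem cramer_upper (ν : Measure ℝ) [IsProbabilityMeasure ν] {x a : ℝ}
    (h : (a : EReal) < cramerRate ν x) :
    ∃ U, IsOpen U ∧ x ∈ U ∧ ∀ᶠ N in atTop, sampleMeanLaw ν N U ≤ expScale a N := by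
  obtain ⟨ρ, L, hL, hx⟩ := (lt_cramerRate_iff ν).1 h
  have hU : IsOpen {y : ℝ | a < ρ * y - L} :=
    isOpen_lt (by fun_prop) (by fun_prop)
  refine ⟨_, hU, hx, ?_⟩
  filter_upwards [eventually_gt_atTop 0] with N hN
  exact sampleMeanLaw_le_expScale ν hL.le hU.measurableSet (fun y hy => le_of_lt hy) hN

theorem exists_laplace_lt_top {ν : Measure ℝ}
    (h : (0 : ℝ) ∈ interior {ρ : ℝ | logMGF ν ρ < ⊤}) :
    ∃ r : ℝ, 0 < r ∧ laplace ν 0 r ≠ ⊤ ∧ laplace ν 0 (-r) ≠ ⊤ := by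
  obtain ⟨ε, hε, hball⟩ := Metric.mem_nhds_iff.1 (mem_interior_iff_mem_nhds.1 h)
  have key : ∀ ρ ∈ Metric.ball (0 : ℝ) ε, laplace ν 0 ρ ≠ ⊤ := by
    intro ρ hρ
    have := hball hρ
    rw [Set.mem_ofPred_eq, logMGF_eq, ENNReal.log_lt_top_iff] at this
    exact this.ne
  refine ⟨ε / 2, by positivity, key _ ?_, key _ ?_⟩
  · simp [abs_of_pos hε, hε]
  · simp [abs_of_pos hε, hε]

theorem cramer_tight (ν : Measure ℝ) [IsProbabilityMeasure ν]
    (h : (0 : ℝ) ∈ interior {ρ : ℝ | logMGF ν ρ < ⊤}) (a : ℝ) :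
    ∃ K, IsCompact K ∧ ∀ᶠ N in atTop, sampleMeanLaw ν N Kᶜ ≤ expScale a N := by
  obtain ⟨r, hr, h1, h2⟩ := exists_laplace_lt_top h
  have hb : ∀ {z : ℝ≥0∞}, z ≠ ⊤ → ∃ L : ℝ, z ≤ ENNReal.ofReal (Real.exp L) := by
    intro z hz
    refine ⟨z.toReal, ?_⟩
    rw [← ENNReal.ofReal_toReal hz, ENNReal.toReal_ofReal ENNReal.toReal_nonneg]
    exact ENNReal.ofReal_le_ofReal ((le_add_of_nonneg_right zero_le_one).trans
      (Real.add_one_le_exp _))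
  obtain ⟨L₁, hL₁⟩ := hb h1
  obtain ⟨L₂, hL₂⟩ := hb h2
  -- `M` makes both `r M - L₁` and `r M - L₂` at least `a + 1`; the extra `1` pays for the factor
  -- `2` from the two tails.
  set M := (a + 1 + |L₁| + |L₂|) / r with hM
  have hrM : r * M = a + 1 + |L₁| + |L₂| := by rw [hM]; field_simp
  refine ⟨Set.Icc (-M) M, isCompact_Icc, ?_⟩
  have hsub : (Set.Icc (-M) M)ᶜ ⊆ Set.Ioi M ∪ Set.Iio (-M) := by
    intro y hy
    by_contra hy'
    simp only [Set.mem_union, Set.mem_Ioi, Set.mem_Iio, not_or, not_lt] at hy'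
    exact hy ⟨hy'.2, hy'.1⟩
  filter_upwards [eventually_gt_atTop 0,
    eventually_mul_expScale_le (lt_add_one a) (C := 2) (by simp)] with N hN hN2
  refine (measure_mono hsub).trans ((measure_union_le _ _).trans (le_trans ?_ hN2))
  rw [two_mul]
  refine add_le_add (sampleMeanLaw_le_expScale ν hL₁ measurableSet_Ioi ?_ hN)
    (sampleMeanLaw_le_expScale ν hL₂ measurableSet_Iio ?_ hN)
  · intro y hy
    have := mul_lt_mul_of_pos_left hy hr
    linarith [le_abs_self L₁, abs_nonneg L₂]
  · intro y hy
    have := mul_lt_mul_of_pos_left hy hr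
    linarith [le_abs_self L₂, abs_nonneg L₁]

/-- The rate function vanishes at the mean, and therefore contracts along segments to it. -/
theorem exists_cramerRate_contract (ν : Measure ℝ) [IsProbabilityMeasure ν]
    (h : (0 : ℝ) ∈ interior {ρ : ℝ | logMGF ν ρ < ⊤}) :
    ∃ m : ℝ, ∀ x t : ℝ, 0 ≤ t → t ≤ 1 →
      cramerRate ν (m + t * (x - m)) ≤ ENNReal.ofReal t * cramerRate ν x := by
  have hint : ∀ ρ : ℝ, laplace ν 0 ρ ≠ ⊤ → Integrable (fun y => Real.exp (ρ * y)) ν := by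
    intro ρ hρ
    refine (lintegral_ofReal_ne_top_iff_integrable (by fun_prop)
      (ae_of_all _ fun y => (Real.exp_pos _).le)).1 ?_
    simpa [laplace] using hρ
  have hid : Integrable (fun y : ℝ => y) ν := by
    obtain ⟨r, hr, h1, h2⟩ := exists_laplace_lt_top h
    have h3 := (hint r h1).add (hint (-r) h2)
    -- The domination used is `r |y| ≤ exp (r y) + exp (-r y)`.
    refine Integrable.mono' (h3.const_mul r⁻¹) (by fun_prop) (ae_of_all _ fun y => ?_)
    have h4 := Real.add_one_le_exp (r * y)
    have h5 := Real.add_one_le_exp (-r * y)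
    have h6 := Real.exp_pos (r * y)
    have h7 := Real.exp_pos (-r * y)
    rw [Real.norm_eq_abs, Pi.add_apply, inv_mul_eq_div, le_div_iff₀ hr]
    rcases abs_cases y with ⟨hy, _⟩ | ⟨hy, _⟩ <;> rw [hy] <;> linarith
  refine ⟨∫ y, y ∂ν, fun x t ht0 ht1 => ?_⟩
  set m := ∫ y, y ∂ν
  -- Jensen's inequality, proved by integrating the tangent bound `exp (ρ y) ≥ exp L * (1 + (ρ y -
  -- L))`.
  have hm : ∀ ρ L : ℝ, laplace ν 0 ρ = ENNReal.ofReal (Real.exp L) → ρ * m - L ≤ 0 := by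
    intro ρ L hL
    have hi := hint ρ (hL ▸ ENNReal.ofReal_ne_top)
    have h1 : ∫ y, Real.exp (ρ * y) ∂ν = Real.exp L := by
      rw [integral_eq_lintegral_of_nonneg_ae (ae_of_all _ fun y => (Real.exp_pos _).le)
        (by fun_prop)]
      have : ∫⁻ y, ENNReal.ofReal (Real.exp (ρ * y)) ∂ν = ENNReal.ofReal (Real.exp L) := by
        simpa [laplace] using hL
      rw [this, ENNReal.toReal_ofReal (Real.exp_pos _).le]
    have h2 : ∫ y, Real.exp L * (1 + (ρ * y - L)) ∂ν ≤ ∫ y, Real.exp (ρ * y) ∂ν := by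
      refine integral_mono ?_ hi fun y => ?_
      · exact ((integrable_const 1).add ((hid.const_mul ρ).sub (integrable_const L))).const_mul _
      · have h8 := Real.add_one_le_exp (ρ * y - L)
        have : Real.exp (ρ * y) = Real.exp L * Real.exp (ρ * y - L) := by
          rw [← Real.exp_add]; ring_nf
        simp only
        rw [this]
        gcongr
        linarith
    have h3 : ∫ y, (1 + (ρ * y - L)) ∂ν = 1 + (ρ * m - L) := by
      rw [integral_add (f := fun _ => (1 : ℝ)) (g := fun y => ρ * y - L) (integrable_const _)
        ((hid.const_mul ρ).sub (integrable_const L)), integral_sub (hid.const_mul ρ)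
        (integrable_const L), integral_const_mul]
      simp [m]
    rw [integral_const_mul, h1, h3] at h2
    have := (mul_le_iff_le_one_right (Real.exp_pos L)).1 h2
    linarith
  rcases eq_or_ne (cramerRate ν x) ⊤ with htop | htop
  · rcases ht0.eq_or_lt with rfl | ht
    -- Here `0 * ∞ = 0`, so the vanishing of the rate at the mean really has to be shown.
    · rw [htop]
      simp only [zero_mul, add_zero, ENNReal.ofReal_zero]
      rw [← EReal.coe_ennreal_le_coe_ennreal_iff]
      simpa using (cramerRate_le_iff ν (a := 0)).2 hm
    · rw [htop, ENNReal.mul_top (by simpa using ht)]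
      exact le_top
  · set b := (cramerRate ν x).toReal
    have hb : (cramerRate ν x : EReal) = b := (EReal.coe_ennreal_toReal htop).symm
    have hb0 : 0 ≤ b := ENNReal.toReal_nonneg
    rw [← ENNReal.ofReal_toReal htop, ← ENNReal.ofReal_mul ht0,
      ← EReal.coe_ennreal_le_coe_ennreal_iff, EReal.coe_ennreal_ofReal,
      max_eq_left (mul_nonneg ht0 hb0), cramerRate_le_iff]
    intro ρ L hL
    have h1 := (cramerRate_le_iff ν).1 hb.le ρ L hL
    have h2 := hm ρ L hL
    have h3 := mul_le_mul_of_nonneg_left h1 ht0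
    have h4 := mul_nonpos_of_nonneg_of_nonpos (sub_nonneg.2 ht1) h2
    linarith

/-! ### Truncated exponential moments -/

/-- The part of `laplace ν x ρ` that comes from `[-M, M]`. -/
def truncLaplace (ν : Measure ℝ) (M x ρ : ℝ) : ℝ≥0∞ :=
  laplace (ν.restrict (Set.Icc (-M) M)) x ρ

/-- Some mass lies at distance at least `η` from `x` on each side, already inside a bounded
interval. Whatever the sign of `ρ`, one of the two sides makes the integrand at least `exp (|ρ| η)`.
The constants do not depend on the truncation level, which is what the compactness argument below
needs. -/
theorem exists_truncLaplace_ge (ν : Measure ℝ) {x : ℝ}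
    (h1 : ν (Set.Ioi x) ≠ 0) (h2 : ν (Set.Iio x) ≠ 0) :
    ∃ η : ℝ, 0 < η ∧ ∃ C : ℝ≥0∞, C ≠ 0 ∧ ∃ M₀ : ℝ, ∀ M, M₀ ≤ M → ∀ ρ : ℝ,
      C * ENNReal.ofReal (Real.exp (|ρ| * η)) ≤ truncLaplace ν M x ρ := by
  have e1 : Set.Ioi x ⊆ ⋃ j : ℕ, Set.Icc (x + ((j : ℝ) + 1)⁻¹) j := by
    intro y hy
    have hy' : 0 < y - x := sub_pos.2 hy
    obtain ⟨j, hj⟩ := exists_nat_ge (max y (y - x)⁻¹)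
    refine Set.mem_iUnion.2 ⟨j, ?_, (le_max_left _ _).trans hj⟩
    have : ((j : ℝ) + 1)⁻¹ ≤ y - x := by
      rw [inv_le_comm₀ (by positivity) hy']
      exact ((le_max_right _ _).trans hj).trans (by linarith)
    linarith
  have e2 : Set.Iio x ⊆ ⋃ j : ℕ, Set.Icc (-(j : ℝ)) (x - ((j : ℝ) + 1)⁻¹) := by
    intro y hy
    have hy' : 0 < x - y := sub_pos.2 hy
    obtain ⟨j, hj⟩ := exists_nat_ge (max (-y) (x - y)⁻¹)
    refine Set.mem_iUnion.2 ⟨j, by linarith [(le_max_left _ _).trans hj], ?_⟩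
    have : ((j : ℝ) + 1)⁻¹ ≤ x - y := by
      rw [inv_le_comm₀ (by positivity) hy']
      exact ((le_max_right _ _).trans hj).trans (by linarith)
    linarith
  obtain ⟨j, hj⟩ := exists_measure_pos_of_not_measure_iUnion_null
    (fun h => h1 (measure_mono_null e1 h))
  obtain ⟨l, hl⟩ := exists_measure_pos_of_not_measure_iUnion_null
    (fun h => h2 (measure_mono_null e2 h))
  have hη1 : (0 : ℝ) < ((j : ℝ) + 1)⁻¹ := by positivity
  have hη2 : (0 : ℝ) < ((l : ℝ) + 1)⁻¹ := by positivity
  refine ⟨min ((j : ℝ) + 1)⁻¹ ((l : ℝ) + 1)⁻¹, lt_min hη1 hη2, min (ν _) (ν _),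
    (lt_min hj hl).ne', |x| + j + l, fun M hM ρ => ?_⟩
  set η := min ((j : ℝ) + 1)⁻¹ ((l : ℝ) + 1)⁻¹
  have hj0 : (0 : ℝ) ≤ j := j.cast_nonneg
  have hl0 : (0 : ℝ) ≤ l := l.cast_nonneg
  have key : ∀ A : Set ℝ, MeasurableSet A → A ⊆ Set.Icc (-M) M →
      (∀ y ∈ A, |ρ| * η ≤ ρ * (y - x)) →
      ν A * ENNReal.ofReal (Real.exp (|ρ| * η)) ≤ truncLaplace ν M x ρ := by
    intro A hA hAM hρ
    calc ν A * ENNReal.ofReal (Real.exp (|ρ| * η))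
        = ∫⁻ _ in A, ENNReal.ofReal (Real.exp (|ρ| * η)) ∂ν := by
          rw [setLIntegral_const, mul_comm]
      _ ≤ ∫⁻ y in A, ENNReal.ofReal (Real.exp (ρ * (y - x))) ∂ν := by
          refine setLIntegral_mono (by fun_prop) fun y hy => ?_
          have := hρ y hy
          gcongr
      _ ≤ truncLaplace ν M x ρ := lintegral_mono_set hAM
  rcases le_total 0 ρ with hρ | hρ
  · refine le_trans ?_ (key (Set.Icc (x + ((j : ℝ) + 1)⁻¹) j) measurableSet_Icc ?_ ?_)
    · exact mul_le_mul_left (min_le_left _ _) _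
    · refine Set.Icc_subset_Icc ?_ ?_
      · linarith [neg_abs_le x]
      · linarith [abs_nonneg x]
    · intro y hy
      rw [abs_of_nonneg hρ]
      have : η ≤ y - x := by linarith [hy.1, min_le_left ((j : ℝ) + 1)⁻¹ ((l : ℝ) + 1)⁻¹]
      gcongr
  · refine le_trans ?_ (key (Set.Icc (-(l : ℝ)) (x - ((l : ℝ) + 1)⁻¹)) measurableSet_Icc ?_ ?_)
    · exact mul_le_mul_left (min_le_right _ _) _
    · refine Set.Icc_subset_Icc ?_ ?_
      · linarith [abs_nonneg x]
      · linarith [le_abs_self x]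
    · intro y hy
      rw [abs_of_nonpos hρ]
      have : η ≤ x - y := by linarith [hy.2, min_le_right ((j : ℝ) + 1)⁻¹ ((l : ℝ) + 1)⁻¹]
      nlinarith

/-- If every truncation level failed, the offending `ρ` would stay bounded by coercivity, and a
subsequence would converge to some `r`. Fatou's lemma would then give `laplace ν x r ≤ c`. -/
theorem exists_lt_truncLaplace (ν : Measure ℝ) [IsFiniteMeasure ν] {x : ℝ} {c : ℝ≥0∞}
    (hc : ∀ ρ, c < laplace ν x ρ) {η : ℝ} (hη : 0 < η) {C : ℝ≥0∞} (hC : C ≠ 0) {M₀ : ℝ}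
    (h : ∀ M, M₀ ≤ M → ∀ ρ : ℝ,
      C * ENNReal.ofReal (Real.exp (|ρ| * η)) ≤ truncLaplace ν M x ρ) :
    ∃ M, M₀ ≤ M ∧ ∀ ρ, c < truncLaplace ν M x ρ := by
  by_contra! hcon
  have hM : ∀ j : ℕ, M₀ ≤ |M₀| + j := fun j => by
    linarith [le_abs_self M₀, (j.cast_nonneg : (0 : ℝ) ≤ j)]
  choose ρ hρ using fun j : ℕ => hcon (|M₀| + j) (hM j)
  have hctop : c ≠ ⊤ := (hc 0).ne_top
  have hbdd : ∀ j, ρ j ∈ Metric.closedBall (0 : ℝ) ((c / C).toReal / η) := by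
    intro j
    have h1 := (h _ (hM j) (ρ j)).trans (hρ j)
    have hCt : C ≠ ⊤ := by
      rintro rfl
      rw [ENNReal.top_mul (by simp [Real.exp_pos])] at h1
      exact hctop (top_le_iff.1 h1)
    rw [mul_comm, ← ENNReal.le_div_iff_mul_le (Or.inl hC) (Or.inl hCt),
      ENNReal.ofReal_le_iff_le_toReal (ENNReal.div_ne_top hctop hC)] at h1
    rw [mem_closedBall_zero_iff, Real.norm_eq_abs, le_div_iff₀ hη]
    linarith [Real.add_one_le_exp (|ρ j| * η)]
  obtain ⟨r, -, φ, hφ, hr⟩ := (isCompact_closedBall _ _).tendsto_subseq hbdd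
  refine (hc r).not_ge ?_
  have hlim : ∀ y, liminf (fun j => (Set.Icc (-(|M₀| + φ j)) (|M₀| + φ j)).indicator
      (fun y => ENNReal.ofReal (Real.exp (ρ (φ j) * (y - x)))) y) atTop =
      ENNReal.ofReal (Real.exp (r * (y - x))) := by
    intro y
    refine Tendsto.liminf_eq ?_
    have h1 : Tendsto (fun j => ENNReal.ofReal (Real.exp (ρ (φ j) * (y - x)))) atTop
        (𝓝 (ENNReal.ofReal (Real.exp (r * (y - x))))) := by
      refine (ENNReal.continuous_ofReal.tendsto _).comp ((Real.continuous_exp.tendsto _).comp ?_)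
      exact hr.mul_const _
    refine h1.congr' ?_
    have h2 : Tendsto (fun j => ((φ j : ℕ) : ℝ)) atTop atTop :=
      tendsto_natCast_atTop_atTop.comp hφ.tendsto_atTop
    filter_upwards [h2.eventually_ge_atTop |y|] with j hj
    rw [Set.indicator_of_mem]
    constructor
    · linarith [neg_abs_le y, abs_nonneg M₀]
    · linarith [le_abs_self y, abs_nonneg M₀]
  calc laplace ν x r = ∫⁻ y, liminf (fun j => (Set.Icc (-(|M₀| + φ j)) (|M₀| + φ j)).indicator
      (fun y => ENNReal.ofReal (Real.exp (ρ (φ j) * (y - x)))) y) atTop ∂ν := by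
        rw [laplace]; exact lintegral_congr fun y => (hlim y).symm
    _ ≤ liminf (fun j => ∫⁻ y, (Set.Icc (-(|M₀| + φ j)) (|M₀| + φ j)).indicator
      (fun y => ENNReal.ofReal (Real.exp (ρ (φ j) * (y - x)))) y ∂ν) atTop :=
        lintegral_liminf_le fun j => Measurable.indicator (by fun_prop) measurableSet_Icc
    _ ≤ liminf (fun _ => c) atTop := by
        refine liminf_le_liminf (Eventually.of_forall fun j => ?_)
        rw [lintegral_indicator measurableSet_Icc]
        exact hρ (φ j)
    _ = c := liminf_const c

/-! ### Tilting -/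

/-- The weak law of large numbers, from Chebyshev's inequality; probability one half is all that the
tilting argument uses. -/
theorem eventually_half_le_pi (m : Measure ℝ) [IsProbabilityMeasure m] (h : MemLp id 2 m) {δ : ℝ}
    (hδ : 0 < δ) :
    ∀ᶠ N : ℕ in atTop, 2⁻¹ ≤
      (Measure.pi fun _ : Fin N => m) {z | |∑ j, z j - N * ∫ y, y ∂m| < N * δ} := by
  have hlim : Tendsto (fun N : ℕ => Var[id; m] / δ ^ 2 / N) atTop (𝓝 0) :=
    tendsto_const_div_atTop_nhds_zero_nat _
  filter_upwards [hlim.eventually_lt_const (by norm_num : (0 : ℝ) < 1 / 2),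
    eventually_gt_atTop 0] with N hN hN0
  have hN' : (0 : ℝ) < N := by exact_mod_cast hN0
  set X : (Fin N → ℝ) → ℝ := ∑ j, fun z => z j with hX
  have hXapp : ∀ z, X z = ∑ j, z j := fun z => by simp [hX]
  have hcoord : ∀ j : Fin N, MemLp (fun z : Fin N → ℝ => z j) 2 (Measure.pi fun _ => m) :=
    fun j => h.comp_measurePreserving (measurePreserving_eval (fun _ : Fin N => m) j)
  have hX2 : MemLp X 2 (Measure.pi fun _ : Fin N => m) :=
    memLp_finsetSum' _ fun j _ => hcoord j
  have hmean : ∫ z, X z ∂(Measure.pi fun _ : Fin N => m) = N * ∫ y, y ∂m := by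
    simp_rw [hXapp]
    rw [integral_finsetSum _ fun j _ => (hcoord j).integrable one_le_two]
    have : ∀ j : Fin N, ∫ z : Fin N → ℝ, z j ∂(Measure.pi fun _ => m) = ∫ y, y ∂m := by
      intro j
      conv_rhs => rw [← (measurePreserving_eval (fun _ : Fin N => m) j).map_eq]
      rw [integral_map (measurable_pi_apply j).aemeasurable (by fun_prop)]
    simp [this]
  have hvar : Var[X; Measure.pi fun _ : Fin N => m] = N * Var[id; m] := by
    have := variance_sum_pi (μ := fun _ : Fin N => m) (X := fun _ => id) fun _ => h
    simpa using this
  have hcheb := meas_ge_le_variance_div_sq hX2 (c := N * δ) (by positivity)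
  rw [hmean, hvar] at hcheb
  have hle : (Measure.pi fun _ : Fin N => m) {z | N * δ ≤ |X z - N * ∫ y, y ∂m|} ≤ 2⁻¹ := by
    refine hcheb.trans ?_
    have : (N * Var[id; m] / (N * δ) ^ 2) = Var[id; m] / δ ^ 2 / N := by field_simp
    rw [this]
    refine (ENNReal.ofReal_le_ofReal hN.le).trans ?_
    rw [one_div, ENNReal.ofReal_inv_of_pos two_pos]
    simp
  have hcompl : {z : Fin N → ℝ | |∑ j, z j - N * ∫ y, y ∂m| < N * δ} =
      {z | N * δ ≤ |X z - N * ∫ y, y ∂m|}ᶜ := by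
    ext z
    simp [hXapp]
  have hmeas : MeasurableSet {z : Fin N → ℝ | N * δ ≤ |X z - N * ∫ y, y ∂m|} := by
    simp_rw [hXapp]
    exact measurableSet_le (by fun_prop) (by fun_prop)
  rw [hcompl, prob_compl_eq_one_sub hmeas]
  calc (2⁻¹ : ℝ≥0∞) = 1 - 2⁻¹ := by rw [ENNReal.one_sub_inv_two]
    _ ≤ _ := tsub_le_tsub_left hle 1

/-- The truncated moment generating function about `x` is finite everywhere and coercive, so it has
a minimiser `ρ`. Its derivative vanishes there, which says that the law tilted by `ρ` has mean `x`.
The weak law puts the tilted sample mean near `x`, and the density bound transfers this to `ν`. -/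
theorem cramer_lower_of_truncLaplace (ν : Measure ℝ) [IsProbabilityMeasure ν] {x M a b : ℝ}
    (hab : a < b) (ha : ∀ ρ, ENNReal.ofReal (Real.exp (-a)) < truncLaplace ν M x ρ)
    {η : ℝ} (hη : 0 < η) {C : ℝ≥0∞} (hC : C ≠ 0)
    (hcoer : ∀ ρ : ℝ, C * ENNReal.ofReal (Real.exp (|ρ| * η)) ≤ truncLaplace ν M x ρ)
    {U : Set ℝ} (hU : IsOpen U) (hx : x ∈ U) :
    ∀ᶠ N in atTop, expScale b N ≤ sampleMeanLaw ν N U := by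
  set ν' := ν.restrict (Set.Icc (-M) M) with hν'
  set X : ℝ → ℝ := fun y => y - x with hX
  have hint : ∀ ρ : ℝ, Integrable (fun y => Real.exp (ρ * X y)) ν' := fun ρ =>
    (by fun_prop : Continuous fun y => Real.exp (ρ * (y - x))).integrableOn_Icc
  have hset : integrableExpSet X ν' = Set.univ := Set.eq_univ_of_forall hint
  have hmgf : ∀ ρ, ENNReal.ofReal (mgf X ν' ρ) = truncLaplace ν M x ρ := fun ρ =>
    ofReal_integral_eq_lintegral_ofReal (hint ρ) (ae_of_all _ fun y => (Real.exp_pos _).le)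
  have hpos : ∀ ρ, Real.exp (-a) < mgf X ν' ρ := fun ρ => by
    have := ha ρ
    rw [← hmgf] at this
    exact (ENNReal.ofReal_lt_ofReal_iff_of_nonneg (Real.exp_pos _).le).1 this
  have hCt : C ≠ ⊤ := by
    rintro rfl
    have := hcoer 0
    rw [← hmgf, ENNReal.top_mul (by simp)] at this
    exact ENNReal.ofReal_ne_top (top_le_iff.1 this)
  have hC0 : 0 < C.toReal := ENNReal.toReal_pos hC hCt
  have hlow : ∀ ρ, C.toReal * (|ρ| * η) ≤ mgf X ν' ρ := by
    intro ρ
    have := hcoer ρ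
    rw [← hmgf, ← ENNReal.ofReal_toReal hCt, ← ENNReal.ofReal_mul hC0.le] at this
    refine le_trans ?_ ((ENNReal.ofReal_le_ofReal_iff
      ((Real.exp_pos _).trans (hpos ρ)).le).1 this)
    gcongr
    linarith [Real.add_one_le_exp (|ρ| * η)]
  have htend : Tendsto (mgf X ν') (cocompact ℝ) atTop := by
    refine tendsto_atTop_mono hlow (Tendsto.const_mul_atTop hC0 (Tendsto.atTop_mul_const hη ?_))
    exact tendsto_norm_cocompact_atTop
  obtain ⟨ρ, hρ⟩ := (continuous_mgf hint).exists_forall_le htend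
  set Z := mgf X ν' ρ with hZ
  have hZ0 : 0 < Z := (Real.exp_pos _).trans (hpos ρ)
  have hν0 : ν' ≠ 0 := by
    intro h
    rw [hZ, h] at hZ0
    simp at hZ0
  have : NeZero ν' := ⟨hν0⟩
  set m := ν'.tilted (fun y => ρ * X y) with hm
  have : IsProbabilityMeasure m := isProbabilityMeasure_tilted (hint ρ)
  have hXm : ∫ y, X y ∂m = 0 := by
    rw [hm, integral_tilted_mul_self (by simp [hset])]
    refine IsLocalMin.deriv_eq_zero (Eventually.of_forall fun r => ?_)
    exact Real.log_le_log hZ0 (hρ r)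
  have hbd : ∀ᵐ y ∂m, ‖id y‖ ≤ M := by
    have h1 : ∀ᵐ y ∂ν', y ∈ Set.Icc (-M) M := ae_restrict_mem measurableSet_Icc
    filter_upwards [(tilted_absolutelyContinuous ν' _).ae_le h1] with y hy
    exact abs_le.2 hy
  have hL2 : MemLp id 2 m := MemLp.of_bound (by fun_prop) M hbd
  have hmean : ∫ y, y ∂m = x := by
    have h1 : ∫ y, X y ∂m = ∫ y, y ∂m - x := by
      refine (integral_sub (hL2.integrable one_le_two) (integrable_const x)).trans ?_
      simp
    linarith
  set g : ℝ → ℝ≥0∞ := (Set.Icc (-M) M).indicator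
    fun y => ENNReal.ofReal (Real.exp (ρ * (y - x)) / Z) with hg
  have hgm : Measurable g := Measurable.indicator (by fun_prop) measurableSet_Icc
  have hmg : m = ν.withDensity g := by
    rw [hg, withDensity_indicator measurableSet_Icc]
    rfl
  obtain ⟨δ₀, hδ₀, hball⟩ := Metric.isOpen_iff.1 hU x hx
  -- The tilt varies by at most `|ρ| δ` per coordinate on the event, and this has to stay below `b -
  -- a`; the `+ 1` covers `ρ = 0`.
  set δ := min δ₀ ((b - a) / (2 * (|ρ| + 1))) with hδ
  have hρ1 : 0 < |ρ| + 1 := by positivity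
  have hδ0 : 0 < δ := lt_min hδ₀ (div_pos (sub_pos.2 hab) (by positivity))
  have hδ2 : a + |ρ| * δ < b := by
    have h1 : δ * (2 * (|ρ| + 1)) ≤ b - a :=
      (le_div_iff₀ (by positivity)).1 (min_le_right _ _)
    nlinarith [abs_nonneg ρ]
  filter_upwards [eventually_half_le_pi m hL2 hδ0, eventually_gt_atTop 0,
    eventually_mul_expScale_le hδ2 (C := 2) (by simp)] with N hN hN0 hNb
  rw [hmean] at hN
  have hN' : (0 : ℝ) < N := by exact_mod_cast hN0
  set E : Set (Fin N → ℝ) := {z | |∑ j, z j - N * x| < N * δ} with hE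
  have hEm : MeasurableSet E := measurableSet_lt (by fun_prop) (by fun_prop)
  have hsub : E ⊆ {z | (∑ j, z j) / N ∈ U} := by
    intro z hz
    refine hball ?_
    rw [Metric.mem_ball, Real.dist_eq]
    have h1 : (∑ j, z j) / N - x = (∑ j, z j - N * x) / N := by field_simp
    rw [h1, abs_div, abs_of_pos hN', div_lt_iff₀ hN']
    have h2 : |∑ j, z j - N * x| < N * δ := hz
    have h3 : δ ≤ δ₀ := min_le_left _ _
    nlinarith
  -- Each factor `1 / Z` is at most `exp a`, and the exponent of the tilt is at most `|ρ| N δ` on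
  -- `E`.
  have hdens : ∀ z ∈ E, ∏ j, g (z j) ≤ expScale (-(a + |ρ| * δ)) N := by
    intro z hz
    calc ∏ j, g (z j) ≤ ∏ j, ENNReal.ofReal (Real.exp (ρ * (z j - x)) * Real.exp a) := by
          refine Finset.prod_le_prod' fun j _ => ?_
          refine (Set.indicator_le_self _ _ _).trans (ENNReal.ofReal_le_ofReal ?_)
          rw [div_eq_mul_inv]
          gcongr
          rw [← neg_neg a, Real.exp_neg (-a)]
          exact inv_anti₀ (Real.exp_pos _) (hpos ρ).le
      _ = ENNReal.ofReal (Real.exp (ρ * (∑ j, z j - N * x) + N * a)) := by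
          rw [← ENNReal.ofReal_prod_of_nonneg fun _ _ => by positivity]
          simp_rw [← Real.exp_add]
          rw [← Real.exp_sum, Finset.sum_add_distrib, ← Finset.mul_sum, Finset.sum_sub_distrib]
          simp
      _ ≤ expScale (-(a + |ρ| * δ)) N := by
          refine ENNReal.ofReal_le_ofReal (Real.exp_le_exp.2 ?_)
          have h1 : ρ * (∑ j, z j - N * x) ≤ |ρ| * (N * δ) := by
            refine (le_abs_self _).trans ?_
            rw [abs_mul]
            have : |∑ j, z j - N * x| < N * δ := hz
            gcongr
          linarith
  have hkey : (2⁻¹ : ℝ≥0∞) ≤ expScale (-(a + |ρ| * δ)) N *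
      (Measure.pi fun _ : Fin N => ν) E := by
    have hp : IsProbabilityMeasure (ν.withDensity g) := hmg ▸ ‹IsProbabilityMeasure m›
    calc (2⁻¹ : ℝ≥0∞) ≤ (Measure.pi fun _ : Fin N => m) E := hN
      _ = ∫⁻ z in E, ∏ j, g (z j) ∂(Measure.pi fun _ : Fin N => ν) := by
          rw [hmg, pi_withDensity ν hgm, withDensity_apply _ hEm]
      _ ≤ ∫⁻ z in E, expScale (-(a + |ρ| * δ)) N ∂(Measure.pi fun _ : Fin N => ν) :=
          setLIntegral_mono (by fun_prop) hdens
      _ = _ := by rw [setLIntegral_const]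
  rw [sampleMeanLaw_apply ν N hU.measurableSet]
  refine le_trans ?_ (measure_mono hsub)
  rw [← expScale_inv] at hkey
  have h2 : expScale (a + |ρ| * δ) N * 2⁻¹ ≤ (Measure.pi fun _ : Fin N => ν) E := by
    calc expScale (a + |ρ| * δ) N * 2⁻¹
        ≤ expScale (a + |ρ| * δ) N * ((expScale (a + |ρ| * δ) N)⁻¹ *
          (Measure.pi fun _ : Fin N => ν) E) := by gcongr
      _ = _ := by
          rw [← mul_assoc, ENNReal.mul_inv_cancel (expScale_pos _ _).ne' (expScale_ne_top _ _),
            one_mul]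
  refine le_trans ?_ h2
  rw [← div_eq_mul_inv, ENNReal.le_div_iff_mul_le (by simp) (by simp), mul_comm]
  exact hNb

/-! ### Cramér's theorem -/

/-- With all mass on one side of `x`, letting `ρ` tend to infinity with the right sign kills
everything except the atom at `x`, by dominated convergence with bound `1`. -/
theorem le_measure_singleton_of_lt_laplace (ν : Measure ℝ) [IsFiniteMeasure ν] {x : ℝ} {c : ℝ≥0∞}
    (hc : ∀ ρ, c < laplace ν x ρ) {s : ℝ} (hs : s ≠ 0) (hν : ∀ᵐ y ∂ν, s * (y - x) ≤ 0) :
    c ≤ ν {x} := by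
  have hlim : Tendsto (fun j : ℕ => laplace ν x (j * s)) atTop
      (𝓝 (∫⁻ y, ({x} : Set ℝ).indicator 1 y ∂ν)) := by
    refine tendsto_lintegral_of_dominated_convergence 1 (fun j => by fun_prop) ?_ ?_ ?_
    · intro j
      filter_upwards [hν] with y hy
      rw [Pi.one_apply, ENNReal.ofReal_le_one, Real.exp_le_one_iff, mul_assoc]
      exact mul_nonpos_of_nonneg_of_nonpos j.cast_nonneg hy
    · simp
    · filter_upwards [hν] with y hy
      by_cases hyx : y = x
      · simp [hyx]
      · rw [Set.indicator_of_notMem (by simpa using hyx)]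
        have hneg : s * (y - x) < 0 :=
          lt_of_le_of_ne hy (mul_ne_zero hs (sub_ne_zero.2 hyx))
        have h1 : Tendsto (fun j : ℕ => (j : ℝ) * s * (y - x)) atTop atBot := by
          simp_rw [mul_assoc]
          exact tendsto_natCast_atTop_atTop.atTop_mul_const_of_neg hneg
        simpa [Function.comp_def] using
          (ENNReal.continuous_ofReal.tendsto 0).comp (Real.tendsto_exp_atBot.comp h1)
  rw [lintegral_indicator_one (measurableSet_singleton x)] at hlim
  exact ge_of_tendsto' hlim fun j => (hc _).le

theorem cramer_lower_of_singleton (ν : Measure ℝ) [IsProbabilityMeasure ν] {x a : ℝ}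
    (h : ENNReal.ofReal (Real.exp (-a)) ≤ ν {x}) {U : Set ℝ} (hU : IsOpen U) (hx : x ∈ U) :
    ∀ᶠ N in atTop, expScale a N ≤ sampleMeanLaw ν N U := by
  filter_upwards [eventually_gt_atTop 0] with N hN
  have hN' : (0 : ℝ) < N := by exact_mod_cast hN
  rw [sampleMeanLaw_apply ν N hU.measurableSet]
  calc expScale a N = ENNReal.ofReal (Real.exp (-a)) ^ N := by
        rw [expScale, ← ENNReal.ofReal_pow (Real.exp_pos _).le, ← Real.exp_nat_mul]
        congr 2
        ring
    _ ≤ ν {x} ^ N := by gcongr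
    _ = (Measure.pi fun _ : Fin N => ν) (Set.univ.pi fun _ => {x}) := by simp
    _ ≤ _ := by
        refine measure_mono fun z hz => ?_
        have : ∀ j, z j = x := fun j => hz j trivial
        simp only [Set.mem_ofPred_eq, this]
        simpa [hN'.ne'] using hx

/-- The hypothesis bounds `laplace ν x` below uniformly in `ρ`. If `ν` charges both sides of `x`,
one truncates and tilts. Otherwise the bound forces an atom at `x`, and the event that all
coordinates equal `x` suffices. -/
theorem cramer_lower (ν : Measure ℝ) [IsProbabilityMeasure ν] {x a : ℝ}
    (h : (cramerRate ν x : EReal) < a) {U : Set ℝ} (hU : IsOpen U) (hx : x ∈ U) :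
    ∀ᶠ N in atTop, expScale a N ≤ sampleMeanLaw ν N U := by
  -- Two reals are inserted: `b' < b` makes the bound on `laplace` strict, and `b < a` is the room
  -- that tilting uses up.
  obtain ⟨b, hb, hba⟩ := EReal.lt_iff_exists_real_btwn.1 h
  have hba' : b < a := by exact_mod_cast hba
  obtain ⟨b', hb', hbb⟩ := EReal.lt_iff_exists_real_btwn.1 hb
  have hbb' : b' < b := by exact_mod_cast hbb
  have hlap : ∀ ρ, ENNReal.ofReal (Real.exp (-b)) < laplace ν x ρ := by
    intro ρ
    by_cases htop : laplace ν 0 ρ = ⊤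
    · rw [laplace_eq_mul, htop, ENNReal.mul_top (by simp [Real.exp_pos])]
      exact ENNReal.ofReal_lt_top
    · have hpos : 0 < (laplace ν 0 ρ).toReal := ENNReal.toReal_pos (laplace_ne_zero ν 0 ρ) htop
      have hL : laplace ν 0 ρ = ENNReal.ofReal (Real.exp (Real.log (laplace ν 0 ρ).toReal)) := by
        rw [Real.exp_log hpos, ENNReal.ofReal_toReal htop]
      have h1 := (cramerRate_le_iff ν).1 hb'.le ρ _ hL
      rw [laplace_eq_mul, hL, ← ENNReal.ofReal_mul (Real.exp_pos _).le, ← Real.exp_add,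
        ENNReal.ofReal_lt_ofReal_iff (Real.exp_pos _), Real.exp_lt_exp]
      linarith
  by_cases h1 : ν (Set.Ioi x) = 0
  · refine cramer_lower_of_singleton ν (le_measure_singleton_of_lt_laplace ν (fun ρ =>
      lt_of_le_of_lt ?_ (hlap ρ)) one_ne_zero ?_) hU hx
    · gcongr
    · have : ∀ᵐ y ∂ν, y ∉ Set.Ioi x := measure_eq_zero_iff_ae_notMem.1 h1
      filter_upwards [this] with y hy
      simpa using hy
  by_cases h2 : ν (Set.Iio x) = 0
  · refine cramer_lower_of_singleton ν (le_measure_singleton_of_lt_laplace ν (fun ρ =>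
      lt_of_le_of_lt ?_ (hlap ρ)) (neg_ne_zero.2 one_ne_zero) ?_) hU hx
    · gcongr
    · have : ∀ᵐ y ∂ν, y ∉ Set.Iio x := measure_eq_zero_iff_ae_notMem.1 h2
      filter_upwards [this] with y hy
      simpa using hy
  obtain ⟨η, hη, C, hC, M₀, hM₀⟩ := exists_truncLaplace_ge ν h1 h2
  obtain ⟨M, hM, hMlt⟩ := exists_lt_truncLaplace ν hlap hη hC hM₀
  exact cramer_lower_of_truncLaplace ν hba' hMlt hη hC (hM₀ M hM) hU hx

theorem localLDP_sampleMeanLaw (ν : Measure ℝ) [IsProbabilityMeasure ν]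
    (h : (0 : ℝ) ∈ interior {ρ : ℝ | logMGF ν ρ < ⊤}) :
    LocalLDP (sampleMeanLaw ν) (cramerRate ν) where
  lowerSemicontinuous := lowerSemicontinuous_cramerRate ν
  upper _ _ := cramer_upper ν
  lower _ _ ha _ hU hx := cramer_lower ν ha hU hx
  tight := cramer_tight ν h

/-! ### Symmetric spins -/

/-- The law of a symmetric `±1` variable. -/
def spinLaw : Measure ℝ :=
  (2 : ℝ≥0∞)⁻¹ • ∑ u : ℤˣ, Measure.dirac ((u : ℤ) : ℝ)

theorem spinLaw_apply {U : Set ℝ} (hU : MeasurableSet U) :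
    spinLaw U = 2⁻¹ * ∑ u : ℤˣ, U.indicator 1 ((u : ℤ) : ℝ) := by
  simp [spinLaw, hU, mul_add]

instance : IsProbabilityMeasure spinLaw where
  measure_univ := by
    rw [spinLaw_apply .univ]
    simp [ENNReal.inv_mul_cancel]

theorem laplace_spinLaw (ρ : ℝ) : laplace spinLaw 0 ρ = ENNReal.ofReal (Real.cosh ρ) := by
  have h2 : (2 : ℝ≥0∞)⁻¹ = ENNReal.ofReal 2⁻¹ := by
    rw [ENNReal.ofReal_inv_of_pos two_pos]
    simp
  rw [laplace, spinLaw, lintegral_smul_measure, lintegral_finsetSum_measure]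
  simp only [lintegral_dirac, smul_eq_mul]
  have hU : (Finset.univ : Finset ℤˣ) = {1, -1} := rfl
  rw [hU, Finset.sum_pair (by decide), h2, ← ENNReal.ofReal_add (Real.exp_pos _).le
    (Real.exp_pos _).le, ← ENNReal.ofReal_mul (by norm_num), Real.cosh_eq]
  congr 1
  push_cast
  simp
  ring

theorem cramerRate_spinLaw_le_iff {y b : ℝ} :
    (cramerRate spinLaw y : EReal) ≤ b ↔ ∀ ρ, ρ * y - Real.log (Real.cosh ρ) ≤ b := by
  rw [cramerRate_le_iff]
  constructor
  · intro h ρ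
    refine h ρ _ ?_
    rw [laplace_spinLaw, Real.exp_log (Real.cosh_pos ρ)]
  · intro h ρ L hL
    rw [laplace_spinLaw, ENNReal.ofReal_eq_ofReal_iff (Real.cosh_pos ρ).le (Real.exp_pos _).le]
      at hL
    have := h ρ
    rwa [hL, Real.log_exp] at this

/-- Apply `1 + w ≤ exp w` at the two spin values, with weights `(1 + y) / 2` and `(1 - y) / 2`; the
two exponentials add up to `2` by the definition of `cosh`. -/
theorem sub_log_cosh_le {y : ℝ} (hy : |y| ≤ 1) (ρ : ℝ) :
    ρ * y - Real.log (Real.cosh ρ) ≤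
      (1 + y) / 2 * Real.log (1 + y) + (1 - y) / 2 * Real.log (1 - y) := by
  obtain ⟨hy1, hy2⟩ := abs_le.1 hy
  set t := Real.log (Real.cosh ρ) with ht
  have key : ∀ u r : ℝ, 0 ≤ u → u / 2 * (r - Real.log u - t) ≤ Real.exp (r - t) / 2 - u / 2 := by
    intro u r hu
    rcases hu.eq_or_lt with rfl | hu
    · rw [zero_div, zero_mul, sub_zero]
      positivity
    · have h1 := Real.add_one_le_exp (r - Real.log u - t)
      have h2 : Real.exp (r - t) = u * Real.exp (r - Real.log u - t) := by
        conv_rhs => rw [← Real.exp_log hu]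
        rw [← Real.exp_add, Real.log_exp]
        ring_nf
      rw [h2]
      nlinarith
  have h1 := key (1 + y) ρ (by linarith)
  have h2 := key (1 - y) (-ρ) (by linarith)
  have h3 : Real.exp (ρ - t) + Real.exp (-ρ - t) = 2 := by
    rw [Real.exp_sub, Real.exp_sub, ht, Real.exp_log (Real.cosh_pos ρ), ← add_div,
      div_eq_iff (Real.cosh_pos ρ).ne', Real.cosh_eq]
    ring
  linarith

/-- The maximiser is `artanh y`, where `cosh` equals `1 / √(1 - y²)`. -/
theorem exists_sub_log_cosh_eq {y : ℝ} (hy : |y| < 1) :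
    ∃ ρ, ρ * y - Real.log (Real.cosh ρ) =
      (1 + y) / 2 * Real.log (1 + y) + (1 - y) / 2 * Real.log (1 - y) := by
  obtain ⟨hy1, hy2⟩ := abs_lt.1 hy
  set u := Real.log (1 + y) / 2 with hu
  set v := Real.log (1 - y) / 2 with hv
  have h1 : Real.cosh (u - v) = Real.exp (-(u + v)) := by
    have e1 : Real.exp (u + u) = 1 + y := by
      rw [hu, add_halves, Real.exp_log (by linarith)]
    have e2 : Real.exp (v + v) = 1 - y := by
      rw [hv, add_halves, Real.exp_log (by linarith)]
    rw [Real.exp_neg, ← mul_eq_one_iff_eq_inv₀ (Real.exp_pos _).ne', Real.cosh_eq, div_mul_eq_mul_div,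
      add_mul, ← Real.exp_add, ← Real.exp_add]
    have e3 : u - v + (u + v) = u + u := by ring
    have e4 : -(u - v) + (u + v) = v + v := by ring
    rw [e3, e4, e1, e2]
    norm_num
  refine ⟨u - v, ?_⟩
  rw [h1, Real.log_exp, hu, hv]
  ring

/-- At the endpoints the supremum is only approached, as `|ρ| → ∞`: `r - log (cosh r)` tends to `log
2`. -/
theorem cramerRate_spinLaw_of_abs_eq_one {y : ℝ} (hy : |y| = 1) {b : ℝ}
    (hb : ∀ ρ, ρ * y - Real.log (Real.cosh ρ) ≤ b) : Real.log 2 ≤ b := by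
  have h1 : ∀ r : ℝ, Real.log 2 - Real.exp (-2 * r) ≤ b := by
    intro r
    have h2 : r - Real.log (Real.cosh r) ≤ b := by
      rcases (abs_eq zero_le_one).1 hy with rfl | rfl
      · simpa using hb r
      · simpa using hb (-r)
    have h3 : Real.cosh r = Real.exp r / 2 * (1 + Real.exp (-2 * r)) := by
      rw [Real.cosh_eq, mul_add, div_mul_eq_mul_div (Real.exp r) 2 (Real.exp (-2 * r)),
        ← Real.exp_add]
      ring_nf
    have h4 : 0 < 1 + Real.exp (-2 * r) := by positivity
    rw [h3, Real.log_mul (by positivity) h4.ne', Real.log_div (Real.exp_pos _).ne' two_ne_zero,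
      Real.log_exp] at h2
    linarith [Real.log_le_sub_one_of_pos h4]
  have h2 : Tendsto (fun r : ℝ => Real.log 2 - Real.exp (-2 * r)) atTop (𝓝 (Real.log 2 - 0)) := by
    refine tendsto_const_nhds.sub (Real.tendsto_exp_atBot.comp ?_)
    exact tendsto_id.const_mul_atTop_of_neg (by norm_num)
  rw [sub_zero] at h2
  exact le_of_tendsto' h2 h1

theorem not_forall_sub_log_cosh_le {y : ℝ} (hy : 1 < |y|) (b : ℝ) :
    ¬ ∀ ρ, ρ * y - Real.log (Real.cosh ρ) ≤ b := by
  intro h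
  set R := (|b| + 1) / (|y| - 1)
  have hR : R * (|y| - 1) = |b| + 1 := div_mul_cancel₀ _ (sub_pos.2 hy).ne'
  have hR0 : 0 < R := div_pos (by positivity) (sub_pos.2 hy)
  have hlog : Real.log (Real.cosh R) ≤ R := by
    rw [Real.log_le_iff_le_exp (Real.cosh_pos R), Real.cosh_eq]
    have : Real.exp (-R) ≤ Real.exp R := Real.exp_le_exp.2 (by linarith)
    linarith
  have h1 : R * |y| - Real.log (Real.cosh R) ≤ b := by
    rcases abs_cases y with ⟨e, _⟩ | ⟨e, _⟩ <;> rw [e]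
    · exact h R
    · simpa using h (-R)
  linarith [le_abs_self b]

theorem spinRate_eq_cramerRate : spinRate = cramerRate spinLaw := by
  funext y
  set h := (1 + y) / 2 * Real.log (1 + y) + (1 - y) / 2 * Real.log (1 - y) with hh
  rcases le_or_gt |y| 1 with hy | hy
  · rw [spinRate, if_pos hy, ← hh]
    have h0 : 0 ≤ h := by simpa using sub_log_cosh_le hy 0
    refine le_antisymm ?_ ?_
    · rcases eq_or_ne (cramerRate spinLaw y) ⊤ with htop | htop
      · simp [htop]
      rw [ENNReal.ofReal_le_iff_le_toReal htop]
      have hb := cramerRate_spinLaw_le_iff.1 (EReal.coe_ennreal_toReal htop).ge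
      rcases hy.lt_or_eq with hlt | heq
      · obtain ⟨ρ, hρ⟩ := exists_sub_log_cosh_eq hlt
        exact hρ.symm.le.trans (hb ρ)
      · have : h = Real.log 2 := by
          rcases (abs_eq zero_le_one).1 heq with rfl | rfl <;> norm_num [hh]
        rw [this]
        exact cramerRate_spinLaw_of_abs_eq_one heq hb
    · rw [← EReal.coe_ennreal_le_coe_ennreal_iff, EReal.coe_ennreal_ofReal, max_eq_left h0,
        cramerRate_spinLaw_le_iff]
      exact sub_log_cosh_le hy
  · rw [spinRate, if_neg hy.not_ge]
    symm
    by_contra htop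
    exact not_forall_sub_log_cosh_le hy _
      (cramerRate_spinLaw_le_iff.1 (EReal.coe_ennreal_toReal htop).ge)

theorem spinLaw_exp : (0 : ℝ) ∈ interior {ρ : ℝ | logMGF spinLaw ρ < ⊤} := by
  have : {ρ : ℝ | logMGF spinLaw ρ < ⊤} = Set.univ := by
    refine Set.eq_univ_of_forall fun ρ => ?_
    rw [Set.mem_ofPred_eq, logMGF_eq, laplace_spinLaw, ENNReal.log_lt_top_iff]
    exact ENNReal.ofReal_lt_top
  simp [this]

/-! ### Change of scale -/

theorem coe_lt_ofReal_mul_iff {p : ℝ} (hp : 0 < p) {a : ℝ} {c : ℝ≥0∞} :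
    (a : EReal) < (ENNReal.ofReal p * c : ℝ≥0∞) ↔ ((a / p : ℝ) : EReal) < c := by
  rcases eq_or_ne c ⊤ with rfl | hc
  · rw [ENNReal.mul_top (by simpa using hp)]
    simp [EReal.coe_lt_top]
  · lift c to NNReal using hc
    rw [ENNReal.ofReal, ← ENNReal.coe_mul, EReal.coe_nnreal_eq_coe_real,
      EReal.coe_nnreal_eq_coe_real, EReal.coe_lt_coe_iff, EReal.coe_lt_coe_iff,
      div_lt_iff₀ hp, NNReal.coe_mul, Real.coe_toNNReal _ hp.le, mul_comm p]

theorem ofReal_mul_lt_coe_iff {p : ℝ} (hp : 0 < p) {a : ℝ} {c : ℝ≥0∞} :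
    ((ENNReal.ofReal p * c : ℝ≥0∞) : EReal) < a ↔ (c : EReal) < ((a / p : ℝ) : EReal) := by
  rcases eq_or_ne c ⊤ with rfl | hc
  · rw [ENNReal.mul_top (by simpa using hp)]
    simp
  · lift c to NNReal using hc
    rw [ENNReal.ofReal, ← ENNReal.coe_mul, EReal.coe_nnreal_eq_coe_real,
      EReal.coe_nnreal_eq_coe_real, EReal.coe_lt_coe_iff, EReal.coe_lt_coe_iff,
      lt_div_iff₀ hp, NNReal.coe_mul, Real.coe_toNNReal _ hp.le, mul_comm p]

theorem tendsto_atTop_of_div_tendsto {k : ℕ → ℕ} {p : ℝ} (hp : 0 < p)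
    (hk : Tendsto (fun N : ℕ => (k N : ℝ) / N) atTop (𝓝 p)) : Tendsto k atTop atTop := by
  rw [← tendsto_natCast_atTop_iff (R := ℝ)]
  refine (hk.pos_mul_atTop hp (tendsto_natCast_atTop_atTop (R := ℝ))).congr' ?_
  filter_upwards [eventually_gt_atTop 0] with N hN
  have : (N : ℝ) ≠ 0 := by exact_mod_cast hN.ne'
  field_simp

theorem eventually_expScale_le_expScale {k : ℕ → ℕ} {p a b : ℝ}
    (hk : Tendsto (fun N : ℕ => (k N : ℝ) / N) atTop (𝓝 p)) (h : a < p * b) :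
    ∀ᶠ N in atTop, expScale b (k N) ≤ expScale a N := by
  filter_upwards [(hk.mul_const b).eventually_const_lt h, eventually_gt_atTop 0] with N hN hN0
  have : (0 : ℝ) < N := by exact_mod_cast hN0
  refine ENNReal.ofReal_le_ofReal (Real.exp_le_exp.2 (neg_le_neg ?_))
  have h1 : (k N : ℝ) * b = N * (k N / N * b) := by field_simp
  rw [h1]
  gcongr

theorem eventually_expScale_ge_expScale {k : ℕ → ℕ} {p a b : ℝ}
    (hk : Tendsto (fun N : ℕ => (k N : ℝ) / N) atTop (𝓝 p)) (h : p * b < a) :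
    ∀ᶠ N in atTop, expScale a N ≤ expScale b (k N) := by
  filter_upwards [(hk.mul_const b).eventually_lt_const h, eventually_gt_atTop 0] with N hN hN0
  have : (0 : ℝ) < N := by exact_mod_cast hN0
  refine ENNReal.ofReal_le_ofReal (Real.exp_le_exp.2 (neg_le_neg ?_))
  have h1 : (k N : ℝ) * b = N * (k N / N * b) := by field_simp
  rw [h1]
  gcongr

/-- Both the speed and the scaling map change with `N`, through the ratio `k N / N → p`. The ratio
in the map is absorbed by joint continuity of division or multiplication at the limit, and the one
in the speed by a small loss in the exponent. -/
theorem LocalLDP.rescale {ν : ℕ → Measure ℝ} {I : ℝ → ℝ≥0∞} (h : LocalLDP ν I) {k : ℕ → ℕ}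
    {p : ℝ} (hp : 0 < p) (hk : Tendsto (fun N : ℕ => (k N : ℝ) / N) atTop (𝓝 p)) :
    LocalLDP (fun N => (ν (k N)).map fun y : ℝ => y * (k N / N))
      fun y => ENNReal.ofReal p * I (y / p) where
  lowerSemicontinuous := by
    refine (ENNReal.continuous_const_mul ENNReal.ofReal_ne_top).comp_lowerSemicontinuous
      (h.lowerSemicontinuous.comp (by fun_prop)) fun a b hab => ?_
    dsimp only
    gcongr
  upper x a ha := by
    rw [coe_lt_ofReal_mul_iff hp] at ha
    obtain ⟨b, hab, hb⟩ := EReal.lt_iff_exists_real_btwn.1 ha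
    have hab' : a < p * b := (div_lt_iff₀' hp).1 (by exact_mod_cast hab)
    obtain ⟨U, hU, hxU, hUN⟩ := h.upper _ b hb
    have hc : ContinuousAt (fun q : ℝ × ℝ => q.1 / q.2) (x, p) :=
      continuousAt_fst.div continuousAt_snd hp.ne'
    obtain ⟨V, W, hV, hxV, hW, hpW, hVW⟩ :=
      mem_nhds_prod_iff'.1 (hc.preimage_mem_nhds (hU.mem_nhds hxU))
    refine ⟨V, hV, hxV, ?_⟩
    filter_upwards [(tendsto_atTop_of_div_tendsto hp hk).eventually hUN,
      eventually_expScale_le_expScale hk hab', hk.eventually (hW.mem_nhds hpW),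
      hk.eventually_const_lt hp] with N h1 h2 h3 h4
    rw [Measure.map_apply (by fun_prop) hV.measurableSet]
    refine (measure_mono fun y hy => ?_).trans (h1.trans h2)
    have : y * ((k N : ℝ) / N) / ((k N : ℝ) / N) ∈ U :=
      hVW (Set.mk_mem_prod (show y * ((k N : ℝ) / N) ∈ V from hy) h3)
    rwa [mul_div_cancel_right₀ _ h4.ne'] at this
  lower x a ha V hV hxV := by
    rw [ofReal_mul_lt_coe_iff hp] at ha
    obtain ⟨b, hb, hab⟩ := EReal.lt_iff_exists_real_btwn.1 ha
    have hab' : p * b < a := (lt_div_iff₀' hp).1 (by exact_mod_cast hab)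
    have hc : ContinuousAt (fun q : ℝ × ℝ => q.1 * q.2) (x / p, p) :=
      continuousAt_fst.mul continuousAt_snd
    have hV' : V ∈ 𝓝 (x / p * p) := by
      rw [div_mul_cancel₀ _ hp.ne']
      exact hV.mem_nhds hxV
    obtain ⟨U, W, hU, hxU, hW, hpW, hUW⟩ := mem_nhds_prod_iff'.1 (hc.preimage_mem_nhds hV')
    filter_upwards [(tendsto_atTop_of_div_tendsto hp hk).eventually (h.lower _ b hb U hU hxU),
      eventually_expScale_ge_expScale hk hab', hk.eventually (hW.mem_nhds hpW)] with N h1 h2 h3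
    rw [Measure.map_apply (by fun_prop) hV.measurableSet]
    exact (h2.trans h1).trans (measure_mono fun y hy => hUW (Set.mk_mem_prod hy h3))
  tight a := by
    obtain ⟨K, hK, hKN⟩ := h.tight (a / p + 1)
    have hK' : IsCompact ((fun q : ℝ × ℝ => q.1 * q.2) '' (K ×ˢ Set.Icc 0 (p + 1))) :=
      (hK.prod isCompact_Icc).image (by fun_prop)
    refine ⟨_, hK', ?_⟩
    have ha : a < p * (a / p + 1) := by
      rw [mul_add, mul_div_cancel₀ _ hp.ne']
      linarith
    filter_upwards [(tendsto_atTop_of_div_tendsto hp hk).eventually hKN,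
      eventually_expScale_le_expScale hk ha,
      hk.eventually (Icc_mem_nhds hp (lt_add_one p))] with N h1 h2 h3
    rw [Measure.map_apply (by fun_prop) hK'.measurableSet.compl]
    refine (measure_mono fun y hy => ?_).trans (h1.trans h2)
    exact fun hyK => hy ⟨(y, (k N : ℝ) / N), Set.mk_mem_prod hyK h3, rfl⟩

/-! ### Block sums -/

/-- The law of the sum of `k` symmetric spins, divided by `N`. -/
def blockLaw (N k : ℕ) : Measure ℝ :=
  (sampleMeanLaw spinLaw k).map fun y : ℝ => y * (k / N)

theorem pi_spinLaw (k : ℕ) : (Measure.pi fun _ : Fin k => spinLaw) =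
    ((2 : ℝ≥0∞) ^ k)⁻¹ • ∑ σ : Fin k → ℤˣ, Measure.dirac fun j => ((σ j : ℤ) : ℝ) := by
  refine Measure.pi_eq fun s hs => ?_
  simp_rw [spinLaw_apply (hs _)]
  rw [Finset.prod_mul_distrib, Finset.prod_univ_sum, Fintype.piFinset_univ]
  simp only [Measure.smul_apply, Measure.finsetSum_apply, smul_eq_mul, Finset.prod_const,
    Finset.card_univ, Fintype.card_fin, ENNReal.inv_pow]
  congr 1
  refine Finset.sum_congr rfl fun σ _ => ?_
  rw [Measure.dirac_apply' _ (MeasurableSet.univ_pi hs)]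
  by_cases hσ : (fun j => ((σ j : ℤ) : ℝ)) ∈ Set.univ.pi s
  · rw [Set.indicator_of_mem hσ]
    exact (Finset.prod_eq_one fun j _ => Set.indicator_of_mem (hσ j trivial) _).symm
  · rw [Set.indicator_of_notMem hσ]
    obtain ⟨j, hj⟩ : ∃ j, ((σ j : ℤ) : ℝ) ∉ s j := by simpa using hσ
    exact (Finset.prod_eq_zero (Finset.mem_univ j) (Set.indicator_of_notMem hj _)).symm

open Classical in
theorem blockLaw_apply (N k : ℕ) {V : Set ℝ} (hV : MeasurableSet V) :
    blockLaw N k V = ((2 : ℝ≥0∞) ^ k)⁻¹ *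
      (Finset.univ.filter fun σ : Fin k → ℤˣ => (∑ j, ((σ j : ℤ) : ℝ)) / N ∈ V).card := by
  have hm : Measurable fun x : Fin k → ℝ => (∑ j, x j) / k * ((k : ℝ) / N) := by fun_prop
  rw [blockLaw, sampleMeanLaw, Measure.map_map (by fun_prop) (by fun_prop), pi_spinLaw]
  change Measure.map (fun x : Fin k → ℝ => (∑ j, x j) / k * ((k : ℝ) / N)) _ V = _
  rw [Measure.map_apply hm hV]
  simp only [Measure.smul_apply, Measure.finsetSum_apply, smul_eq_mul]
  congr 1
  rw [Finset.card_filter, Nat.cast_sum]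
  refine Finset.sum_congr rfl fun σ _ => ?_
  rw [Measure.dirac_apply' _ (hm hV)]
  have h1 : (∑ j, ((σ j : ℤ) : ℝ)) / k * ((k : ℝ) / N) = (∑ j, ((σ j : ℤ) : ℝ)) / N := by
    rcases Nat.eq_zero_or_pos k with rfl | hk
    · simp
    · have : (k : ℝ) ≠ 0 := by exact_mod_cast hk.ne'
      field_simp
  simp [Set.indicator_apply, h1]

theorem localLDP_blockLaw {k : ℕ → ℕ} {p : ℝ} (hp : 0 < p)
    (hk : Tendsto (fun N : ℕ => (k N : ℝ) / N) atTop (𝓝 p)) :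
    LocalLDP (fun N => blockLaw N (k N)) fun y => ENNReal.ofReal p * spinRate (y / p) := by
  rw [spinRate_eq_cramerRate]
  exact (localLDP_sampleMeanLaw spinLaw spinLaw_exp).rescale hp hk

theorem exists_spinRate_contract {p : ℝ} (hp : 0 < p) :
    ∃ m : ℝ, ∀ x t : ℝ, 0 ≤ t → t ≤ 1 →
      ENNReal.ofReal p * spinRate ((m + t * (x - m)) / p) ≤
        ENNReal.ofReal t * (ENNReal.ofReal p * spinRate (x / p)) := by
  obtain ⟨m, hm⟩ := exists_cramerRate_contract spinLaw spinLaw_exp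
  refine ⟨p * m, fun x t h0 h1 => ?_⟩
  rw [spinRate_eq_cramerRate, mul_left_comm]
  have : (p * m + t * (x - p * m)) / p = m + t * (x / p - m) := by field_simp
  rw [this]
  gcongr
  exact hm _ _ h0 h1

/-! ### The second moment method for counts of events -/

open Classical in
-- The hypothesis says that the variance is at most `η` times the squared mean. Falling below half
-- the mean is a deviation of half the mean, hence the factor `4`.
theorem measure_two_mul_count_lt_le {Ω T : Type*} [MeasurableSpace Ω] (P : Measure Ω)
    [IsProbabilityMeasure P] (F : Finset T) {E : T → Set Ω} (hE : ∀ t, MeasurableSet (E t))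
    {q η : ℝ≥0∞} (hq : ∀ t ∈ F, P (E t) = q) (hq0 : F.card * q ≠ 0) (hqt : q ≠ ⊤)
    (h : ∑ t ∈ F, ∑ u ∈ F, P (E t ∩ E u) ≤ (F.card * q) ^ 2 * (1 + η)) :
    P {ω | 2 * ((F.filter fun t => ω ∈ E t).card : ℝ≥0∞) < F.card * q} ≤ 4 * η := by
  rcases eq_or_ne η ⊤ with rfl | hη
  · simp
  set a : ℝ := (F.card * q).toReal with ha
  have hat : F.card * q ≠ ⊤ := ENNReal.mul_ne_top (ENNReal.natCast_ne_top _) hqt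
  have ha0 : 0 < a := ENNReal.toReal_pos hq0 hat
  set Z : Ω → ℝ := fun ω => ∑ t ∈ F, (E t).indicator 1 ω with hZ
  have hZcount : ∀ ω, Z ω = ((F.filter fun t => ω ∈ E t).card : ℝ) := by
    intro ω
    simp [hZ, Set.indicator_apply]
  have hmem : ∀ t, MemLp ((E t).indicator (1 : Ω → ℝ)) 2 P := fun t =>
    memLp_indicator_const 2 (hE t) (1 : ℝ) (Or.inr (measure_ne_top P _))
  have hZ2 : MemLp Z 2 P := memLp_finsetSum F fun t _ => hmem t
  have hmean : P[Z] = a := by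
    rw [hZ, integral_finsetSum F fun t _ => (hmem t).integrable one_le_two]
    simp_rw [integral_indicator_one (hE _)]
    rw [Finset.sum_congr rfl fun t ht => show P.real (E t) = q.toReal by
      rw [measureReal_def, hq t ht]]
    simp [ha]
  have hsq : P[Z ^ 2] ≤ a ^ 2 * (1 + η.toReal) := by
    have h1 : ∀ ω, (Z ^ 2) ω = ∑ t ∈ F, ∑ u ∈ F, (E t ∩ E u).indicator (1 : Ω → ℝ) ω := by
      intro ω
      rw [Pi.pow_apply, sq, hZ, Finset.sum_mul_sum]
      simp_rw [Set.inter_indicator_one]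
      rfl
    have hint : ∀ t u, Integrable ((E t ∩ E u).indicator (1 : Ω → ℝ)) P := fun t u =>
      (integrable_const (1 : ℝ)).indicator ((hE t).inter (hE u))
    simp_rw [h1]
    rw [integral_finsetSum F fun t _ => integrable_finsetSum F fun u _ => hint t u]
    simp_rw [integral_finsetSum F fun u _ => hint _ u,
      integral_indicator_one ((hE _).inter (hE _)), measureReal_def]
    have h2 := ENNReal.toReal_mono (by finiteness) h
    rw [ENNReal.toReal_mul, ENNReal.toReal_pow, ENNReal.toReal_add (by simp) hη,
      ENNReal.toReal_one, ENNReal.toReal_sum fun t _ =>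
        ENNReal.sum_ne_top.2 fun u _ => measure_ne_top P _] at h2
    refine le_trans (le_of_eq ?_) h2
    exact Finset.sum_congr rfl fun t _ => (ENNReal.toReal_sum fun u _ => by finiteness).symm
  have hvar : Var[Z; P] ≤ a ^ 2 * η.toReal := by
    rw [variance_eq_sub hZ2, hmean]
    linarith
  have hcheb := meas_ge_le_variance_div_sq hZ2 (c := a / 2) (by positivity)
  rw [hmean] at hcheb
  calc P {ω | 2 * ((F.filter fun t => ω ∈ E t).card : ℝ≥0∞) < F.card * q}
      ≤ P {ω | a / 2 ≤ |Z ω - a|} := by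
        refine measure_mono fun ω hω => ?_
        have h1 : 2 * Z ω < a := by
          have := (ENNReal.toReal_lt_toReal (by finiteness) hat).2 hω
          rw [hZcount]
          simpa [ha] using this
        have h2 : a / 2 ≤ -(Z ω - a) := by linarith
        exact h2.trans (neg_le_abs _)
    _ ≤ ENNReal.ofReal (Var[Z; P] / (a / 2) ^ 2) := hcheb
    _ ≤ ENNReal.ofReal (4 * η.toReal) := by
        refine ENNReal.ofReal_le_ofReal ?_
        rw [div_le_iff₀ (by positivity)]
        linarith
    _ = 4 * η := by
        rw [ENNReal.ofReal_mul (by norm_num), ENNReal.ofReal_toReal hη]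
        simp

/-! ### Moments of the number of configurations in a box -/

section Moments

variable {n : ℕ} {S : Finset (List (Fin n))} {κ : Fin n → ℕ} {Ω : Type*} [MeasurableSpace Ω]

/-- The event that the variables attached to `σ` and to the words of `W` lie in the sets `U s`. -/
def wordEvent (ξ : (s : S) → WordConfig κ s → Ω → ℝ) (U : S → Set ℝ) (W : Finset S)
    (σ : Config κ) : Set Ω :=
  ⋂ s ∈ W, ξ s (σ.onWord s) ⁻¹' U s

/-- The words of `S` all of whose symbols lie in `A`. -/
def wordsIn (S : Finset (List (Fin n))) (A : Finset (Fin n)) : Finset S :=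
  Finset.univ.filter fun s => s.1.toFinset ⊆ A

theorem onWord_eq_iff {σ τ : Config κ} {s : List (Fin n)} :
    σ.onWord s = τ.onWord s ↔ ∀ i ∈ s, σ i = τ i := by
  constructor
  · intro h i hi
    exact congrFun h ⟨i, hi⟩
  · intro h
    funext i
    exact h i i.2

/-- The expected number of configurations of the blocks in `A` that satisfy the constraints on
these blocks and on the words over `A`. -/
def subCount (G : (i : Fin n) → Finset (Fin (κ i) → ℤˣ)) (q : S → ℝ≥0∞) (A : Finset (Fin n)) :
    ℝ≥0∞ :=
  (∏ i ∈ A, ((G i).card : ℝ≥0∞)) * ∏ s ∈ wordsIn S A, q s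

variable {P : Measure Ω} {ξ : (s : S) → WordConfig κ s → Ω → ℝ}
  {U : S → Set ℝ} {q : S → ℝ≥0∞}

theorem measurableSet_wordEvent (hm : ∀ s c, Measurable (ξ s c)) (hU : ∀ s, MeasurableSet (U s))
    (W : Finset S) (σ : Config κ) : MeasurableSet (wordEvent ξ U W σ) :=
  Finset.measurableSet_biInter _ fun s _ => hm s _ (hU s)

/-- Each distinct variable counts once, so a word contributes one factor per element of `C s`.
Coinciding restrictions of two configurations are thereby handled automatically. -/
theorem measure_iInter_sigma
    (hi : iIndepFun (fun r : (s : S) × WordConfig κ s => ξ r.1 r.2) P)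
    (hU : ∀ s, MeasurableSet (U s)) (hq : ∀ s c, P (ξ s c ⁻¹' U s) = q s)
    (W : Finset S) (C : (s : S) → Finset (WordConfig κ s)) :
    P (⋂ s ∈ W, ⋂ c ∈ C s, ξ s c ⁻¹' U s) = ∏ s ∈ W, q s ^ (C s).card := by
  have h := hi.measure_inter_preimage_eq_mul (W.sigma C) (sets := fun r => U r.1)
    fun r _ => hU r.1
  rw [Finset.prod_sigma] at h
  simp only [hq, Finset.prod_const] at h
  rw [← h]
  congr 1
  ext ω
  simp only [Set.mem_iInter, Finset.mem_sigma, Sigma.forall, and_imp]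
  exact ⟨fun h s c hs hc => h s hs c hc, fun h s hs c hc => h s c hs hc⟩

theorem measure_wordEvent
    (hi : iIndepFun (fun r : (s : S) × WordConfig κ s => ξ r.1 r.2) P)
    (hU : ∀ s, MeasurableSet (U s)) (hq : ∀ s c, P (ξ s c ⁻¹' U s) = q s)
    (W : Finset S) (σ : Config κ) : P (wordEvent ξ U W σ) = ∏ s ∈ W, q s := by
  have h := measure_iInter_sigma hi hU hq W fun s => {σ.onWord s}
  simpa [wordEvent] using h

open Classical in
theorem measure_wordEvent_inter
    (hi : iIndepFun (fun r : (s : S) × WordConfig κ s => ξ r.1 r.2) P)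
    (hU : ∀ s, MeasurableSet (U s)) (hq : ∀ s c, P (ξ s c ⁻¹' U s) = q s)
    (σ τ : Config κ) :
    P (wordEvent ξ U Finset.univ σ ∩ wordEvent ξ U Finset.univ τ) =
      ∏ s : S, if s ∈ wordsIn S (Finset.univ.filter fun i => σ i = τ i) then q s else q s ^ 2 := by
  have h := measure_iInter_sigma hi hU hq Finset.univ fun s => {σ.onWord s, τ.onWord s}
  have hset : wordEvent ξ U Finset.univ σ ∩ wordEvent ξ U Finset.univ τ =
      ⋂ s ∈ (Finset.univ : Finset S), ⋂ c ∈ ({σ.onWord s, τ.onWord s} : Finset _),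
        ξ s c ⁻¹' U s := by
    ext ω
    simp [wordEvent, forall_and]
  rw [hset, h]
  refine Finset.prod_congr rfl fun s _ => ?_
  have hiff : s ∈ wordsIn S (Finset.univ.filter fun i => σ i = τ i) ↔
      σ.onWord s.1 = τ.onWord s.1 := by
    rw [onWord_eq_iff]
    simp [wordsIn, Finset.subset_iff]
  by_cases hs : σ.onWord s.1 = τ.onWord s.1
  · rw [if_pos (hiff.2 hs), hs]
    simp
  · rw [if_neg fun h' => hs (hiff.1 h'), Finset.card_pair hs]

/-- The union bound for the configurations of the blocks in `A`. -/
theorem measure_exists_wordEvent_le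
    (hi : iIndepFun (fun r : (s : S) × WordConfig κ s => ξ r.1 r.2) P)
    (hU : ∀ s, MeasurableSet (U s)) (hq : ∀ s c, P (ξ s c ⁻¹' U s) = q s)
    (G : (i : Fin n) → Finset (Fin (κ i) → ℤˣ)) (A : Finset (Fin n)) :
    P {ω | ∃ σ ∈ Fintype.piFinset G, ω ∈ wordEvent ξ U Finset.univ σ} ≤ subCount G q A := by
  rcases (Fintype.piFinset G).eq_empty_or_nonempty with h0 | ⟨σ₀, hσ₀⟩
  · simp [h0]
  -- The blocks outside `A` are frozen at `σ₀`, so that the union runs over the choices in `A` only;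
  -- words over `A` do not see the difference.
  set G' : (i : Fin n) → Finset (Fin (κ i) → ℤˣ) := fun i => if i ∈ A then G i else {σ₀ i}
  calc P {ω | ∃ σ ∈ Fintype.piFinset G, ω ∈ wordEvent ξ U Finset.univ σ}
      ≤ P (⋃ σ ∈ Fintype.piFinset G', wordEvent ξ U (wordsIn S A) σ) := by
        refine measure_mono ?_
        rintro ω ⟨(σ : Config κ), hσ, hω⟩
        rw [Fintype.mem_piFinset] at hσ
        refine Set.mem_iUnion₂.2 ⟨fun i => if i ∈ A then σ i else σ₀ i, ?_, ?_⟩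
        · rw [Fintype.mem_piFinset]
          intro i
          by_cases hiA : i ∈ A <;> simp [G', hiA, hσ i]
        · simp only [wordEvent, Set.mem_iInter] at hω ⊢
          intro s hs
          have hsub : s.1.toFinset ⊆ A := by simpa [wordsIn] using hs
          have : Config.onWord (fun i => if i ∈ A then σ i else σ₀ i) s.1 = σ.onWord s.1 :=
            onWord_eq_iff.2 fun i his => if_pos (hsub (List.mem_toFinset.2 his))
          rw [this]
          exact hω s (Finset.mem_univ s)
    _ ≤ ∑ σ ∈ Fintype.piFinset G', P (wordEvent ξ U (wordsIn S A) σ) :=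
        measure_biUnion_finset_le _ _
    _ = subCount G q A := by
        simp_rw [measure_wordEvent hi hU hq]
        rw [Finset.sum_const, nsmul_eq_mul, Fintype.card_piFinset, subCount, Nat.cast_prod]
        congr 1
        rw [← Finset.prod_subset (Finset.subset_univ A)]
        · exact Finset.prod_congr rfl fun i hiA => by simp [G', hiA]
        · intro i _ hiA
          simp [G', hiA]

open Classical in
theorem lintegral_count_wordEvent [IsProbabilityMeasure P] (hm : ∀ s c, Measurable (ξ s c))
    (hi : iIndepFun (fun r : (s : S) × WordConfig κ s => ξ r.1 r.2) P)
    (hU : ∀ s, MeasurableSet (U s)) (hq : ∀ s c, P (ξ s c ⁻¹' U s) = q s)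
    (F : Finset (Config κ)) :
    ∫⁻ ω, ((F.filter fun σ => ω ∈ wordEvent ξ U Finset.univ σ).card : ℝ≥0∞) ∂P =
      F.card * ∏ s, q s := by
  have h : ∀ ω, ((F.filter fun σ => ω ∈ wordEvent ξ U Finset.univ σ).card : ℝ≥0∞) =
      ∑ σ ∈ F, (wordEvent ξ U Finset.univ σ).indicator 1 ω := by
    intro ω
    rw [Finset.card_filter, Nat.cast_sum]
    refine Finset.sum_congr rfl fun σ _ => ?_
    by_cases hω : ω ∈ wordEvent ξ U Finset.univ σ
    · rw [if_pos hω, Set.indicator_of_mem hω, Nat.cast_one, Pi.one_apply]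
    · rw [if_neg hω, Set.indicator_of_notMem hω, Nat.cast_zero]
  simp_rw [h]
  rw [lintegral_finsetSum _ fun σ _ =>
    measurable_one.indicator (measurableSet_wordEvent hm hU _ σ)]
  simp_rw [lintegral_indicator_one (measurableSet_wordEvent hm hU _ _),
    measure_wordEvent hi hU hq]
  simp

theorem prod_ite_sq_mul_prod {ι M : Type*} [Fintype ι] [DecidableEq ι] [CommMonoid M]
    (B : Finset ι) (g : ι → M) :
    (∏ i, if i ∈ B then g i else g i ^ 2) * ∏ i ∈ B, g i = (∏ i, g i) ^ 2 := by
  have h : ∏ i ∈ B, g i = ∏ i, if i ∈ B then g i else 1 := by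
    rw [Finset.prod_ite_mem, Finset.univ_inter]
  rw [h, ← Finset.prod_mul_distrib, ← Finset.prod_pow]
  refine Finset.prod_congr rfl fun i _ => ?_
  split_ifs
  · rw [sq]
  · rw [mul_one]

open Classical in
-- Pairs are sorted by the set `B` of blocks on which they agree. Agreement on `B` removes one
-- factor `(G i).card` for each `i ∈ B` from the number of pairs, and one factor `q s` for each word
-- over `B` from the probability. Together these factors form `subCount G q B`, so the contribution
-- is at most the squared mean divided by it.
theorem sum_measure_wordEvent_inter_le (hS : ∀ s ∈ S, s ≠ [])
    (hi : iIndepFun (fun r : (s : S) × WordConfig κ s => ξ r.1 r.2) P)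
    (hU : ∀ s, MeasurableSet (U s)) (hq : ∀ s c, P (ξ s c ⁻¹' U s) = q s)
    (hq0 : ∀ s, q s ≠ 0) (hqt : ∀ s, q s ≠ ⊤)
    (G : (i : Fin n) → Finset (Fin (κ i) → ℤˣ)) (hG : ∀ i, (G i).Nonempty) :
    ∑ σ ∈ Fintype.piFinset G, ∑ τ ∈ Fintype.piFinset G,
        P (wordEvent ξ U Finset.univ σ ∩ wordEvent ξ U Finset.univ τ) ≤
      ((Fintype.piFinset G).card * ∏ s, q s) ^ 2 *
        (1 + ∑ B ∈ Finset.univ.erase ∅, (subCount G q B)⁻¹) := by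
  set F := Fintype.piFinset G with hF
  set w : Finset (Fin n) → ℝ≥0∞ := fun B => ∏ s : S, if s ∈ wordsIn S B then q s else q s ^ 2
    with hw
  have hcount : ∀ B : Finset (Fin n),
      (((F ×ˢ F).filter fun r => ∀ i ∈ B, r.1 i = r.2 i).card : ℝ≥0∞) ≤
        ∏ i, if i ∈ B then ((G i).card : ℝ≥0∞) else ((G i).card : ℝ≥0∞) ^ 2 := by
    intro B
    set D : (i : Fin n) → Finset ((Fin (κ i) → ℤˣ) × (Fin (κ i) → ℤˣ)) := fun i =>
      if i ∈ B then (G i).image (fun c => (c, c)) else G i ×ˢ G i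
    have h1 : ((F ×ˢ F).filter fun r => ∀ i ∈ B, r.1 i = r.2 i).card ≤
        (Fintype.piFinset D).card := by
      refine Finset.card_le_card_of_injOn (fun r i => (r.1 i, r.2 i)) ?_ ?_
      · intro r hr
        simp only [Finset.coe_filter, Finset.mem_product, hF, Fintype.mem_piFinset,
          Set.mem_ofPred_eq] at hr
        rw [Finset.mem_coe, Fintype.mem_piFinset]
        intro i
        by_cases hiB : i ∈ B
        · simp [D, hiB, hr.2 i hiB, hr.1.2 i]
        · simp [D, hiB, hr.1.1 i, hr.1.2 i]
      · intro r _ r' _ h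
        have h' : ∀ i, (r.1 i, r.2 i) = (r'.1 i, r'.2 i) := fun i => congrFun h i
        refine Prod.ext (funext fun i => ?_) (funext fun i => ?_)
        · exact congrArg Prod.fst (h' i)
        · exact congrArg Prod.snd (h' i)
    refine (Nat.cast_le.2 h1).trans (le_of_eq ?_)
    rw [Fintype.card_piFinset, Nat.cast_prod]
    refine Finset.prod_congr rfl fun i _ => ?_
    by_cases hiB : i ∈ B
    · simp only [D, hiB, if_true]
      rw [Finset.card_image_of_injective _ fun a b h => congrArg Prod.fst h]
    · simp [D, hiB, Finset.card_product, sq]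
  -- Keeping all `B` on which the pair agrees, not only the exact agreement set, overcounts
  -- harmlessly and leaves conditions that are easy to count.
  have hpair : ∀ r ∈ F ×ˢ F,
      P (wordEvent ξ U Finset.univ r.1 ∩ wordEvent ξ U Finset.univ r.2) ≤
        ∑ B : Finset (Fin n), if ∀ i ∈ B, r.1 i = r.2 i then w B else 0 := by
    intro r _
    rw [measure_wordEvent_inter hi hU hq]
    refine le_trans ?_ (Finset.single_le_sum (fun _ _ => zero_le)
      (Finset.mem_univ (Finset.univ.filter fun i => r.1 i = r.2 i)))
    rw [if_pos (by simp)]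
  have hterm : ∀ B : Finset (Fin n),
      ∑ r ∈ F ×ˢ F, (if ∀ i ∈ B, r.1 i = r.2 i then w B else 0) ≤
        (F.card * ∏ s, q s) ^ 2 * (subCount G q B)⁻¹ := by
    intro B
    rw [← Finset.sum_filter, Finset.sum_const, nsmul_eq_mul]
    have hR0 : subCount G q B ≠ 0 := by
      refine mul_ne_zero (Finset.prod_ne_zero_iff.2 fun i _ => ?_)
        (Finset.prod_ne_zero_iff.2 fun s _ => hq0 s)
      exact_mod_cast (hG i).card_pos.ne'
    have hRt : subCount G q B ≠ ⊤ :=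
      ENNReal.mul_ne_top (ENNReal.prod_ne_top fun i _ => ENNReal.natCast_ne_top _)
        (ENNReal.prod_ne_top fun s _ => hqt s)
    rw [← div_eq_mul_inv, ENNReal.le_div_iff_mul_le (Or.inl hR0) (Or.inl hRt)]
    refine (mul_le_mul_left (mul_le_mul_left (hcount B) _) _).trans (le_of_eq ?_)
    have e1 : (∏ i, if i ∈ B then ((G i).card : ℝ≥0∞) else ((G i).card : ℝ≥0∞) ^ 2) *
        ∏ i ∈ B, ((G i).card : ℝ≥0∞) = (F.card : ℝ≥0∞) ^ 2 := by
      rw [prod_ite_sq_mul_prod, hF, Fintype.card_piFinset, Nat.cast_prod]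
    have e2 : w B * ∏ s ∈ wordsIn S B, q s = (∏ s, q s) ^ 2 :=
      prod_ite_sq_mul_prod _ _
    rw [subCount, mul_mul_mul_comm, e1, e2, mul_pow]
  -- The term `B = ∅` must reproduce the squared mean exactly; an empty word in `S` would spoil
  -- this, since its variable would be common to all configurations.
  have hempty : subCount G q ∅ = 1 := by
    have : wordsIn S ∅ = ∅ := by
      refine Finset.filter_eq_empty_iff.2 fun s _ hs => hS s.1 s.2 ?_
      simpa using hs
    simp [subCount, this]
  calc ∑ σ ∈ F, ∑ τ ∈ F, P (wordEvent ξ U Finset.univ σ ∩ wordEvent ξ U Finset.univ τ)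
      = ∑ r ∈ F ×ˢ F, P (wordEvent ξ U Finset.univ r.1 ∩ wordEvent ξ U Finset.univ r.2) := by
        rw [Finset.sum_product]
    _ ≤ ∑ r ∈ F ×ˢ F, ∑ B : Finset (Fin n), (if ∀ i ∈ B, r.1 i = r.2 i then w B else 0) :=
        Finset.sum_le_sum hpair
    _ = ∑ B : Finset (Fin n), ∑ r ∈ F ×ˢ F, (if ∀ i ∈ B, r.1 i = r.2 i then w B else 0) :=
        Finset.sum_comm
    _ ≤ ∑ B : Finset (Fin n), (F.card * ∏ s, q s) ^ 2 * (subCount G q B)⁻¹ :=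
        Finset.sum_le_sum fun B _ => hterm B
    _ = _ := by
        rw [← Finset.mul_sum, ← Finset.add_sum_erase _ _ (Finset.mem_univ ∅), hempty, inv_one]

end Moments

/-! ### The empirical measure of a box -/

section Box

variable {n : ℕ} {S : Finset (List (Fin n))} {N : ℕ} {κ : Fin n → ℕ}

/-- The product set of all `(x, y)` with `x s ∈ U s` and `y i ∈ V i`. -/
def box (U : S → Set ℝ) (V : Fin n → Set ℝ) : Set ((S → ℝ) × (Fin n → ℝ)) :=
  Set.univ.pi U ×ˢ Set.univ.pi V

theorem measurableSet_box {U : S → Set ℝ} {V : Fin n → Set ℝ} (hU : ∀ s, MeasurableSet (U s))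
    (hV : ∀ i, MeasurableSet (V i)) : MeasurableSet (box U V) :=
  (MeasurableSet.univ_pi hU).prod (MeasurableSet.univ_pi hV)

open Classical in
/-- The configurations of the `i`-th block whose normalised sum lies in `V i`. -/
def goodBlocks (N : ℕ) (κ : Fin n → ℕ) (V : Fin n → Set ℝ) (i : Fin n) :
    Finset (Fin (κ i) → ℤˣ) :=
  Finset.univ.filter fun σ => (∑ j, ((σ j : ℤ) : ℝ)) / N ∈ V i

theorem card_goodBlocks {V : Fin n → Set ℝ} (hV : ∀ i, MeasurableSet (V i)) (i : Fin n) :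
    ((goodBlocks N κ V i).card : ℝ≥0∞) = 2 ^ κ i * blockLaw N (κ i) (V i) := by
  rw [blockLaw_apply _ _ (hV i), ← mul_assoc, ENNReal.mul_inv_cancel (by simp)
    (ENNReal.pow_ne_top (by simp)), one_mul]
  rfl

theorem card_config : (Fintype.card (Config κ) : ℝ≥0∞) = ∏ i, (2 : ℝ≥0∞) ^ κ i := by
  rw [Fintype.card_pi, Nat.cast_prod]
  simp

theorem card_piFinset_goodBlocks {V : Fin n → Set ℝ} (hV : ∀ i, MeasurableSet (V i)) :
    ((Fintype.piFinset (goodBlocks N κ V)).card : ℝ≥0∞) =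
      Fintype.card (Config κ) * ∏ i, blockLaw N (κ i) (V i) := by
  rw [Fintype.card_piFinset, Nat.cast_prod, card_config, ← Finset.prod_mul_distrib]
  exact Finset.prod_congr rfl fun i _ => card_goodBlocks hV i

instance : Nonempty (Config κ) := ⟨fun _ _ => 1⟩

open Classical in
theorem empiricalMeasure_box {Ω : Type*} (ξ : (s : S) → WordConfig κ s → Ω → ℝ) (ω : Ω)
    {U : S → Set ℝ} {V : Fin n → Set ℝ} (hU : ∀ s, MeasurableSet (U s))
    (hV : ∀ i, MeasurableSet (V i)) :
    empiricalMeasure S N κ (fun s c => ξ s c ω) (box U V) =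
      (Fintype.card (Config κ) : ℝ≥0∞)⁻¹ *
        ((Fintype.piFinset (goodBlocks N κ V)).filter
          fun σ => ω ∈ wordEvent ξ U Finset.univ σ).card := by
  rw [empiricalMeasure, Measure.smul_apply, Measure.finsetSum_apply, smul_eq_mul]
  congr 1
  rw [← Finset.sum_subset (Finset.subset_univ ((Fintype.piFinset (goodBlocks N κ V)).filter
          fun σ => ω ∈ wordEvent ξ U Finset.univ σ))]
  · rw [Finset.cast_card]
    refine Finset.sum_congr rfl fun (σ : Config κ) hσ => ?_
    rw [Finset.mem_filter, Fintype.mem_piFinset] at hσ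
    rw [Measure.dirac_apply' _ (measurableSet_box hU hV), Set.indicator_of_mem, Pi.one_apply]
    refine ⟨fun s _ => ?_, fun i _ => ?_⟩
    · have := hσ.2
      simp only [wordEvent, Set.mem_iInter] at this
      exact this s (Finset.mem_univ s)
    · exact (Finset.mem_filter.1 (hσ.1 i)).2
  · intro (σ : Config κ) _ hσ
    rw [Measure.dirac_apply' _ (measurableSet_box hU hV), Set.indicator_of_notMem]
    rintro ⟨h1, h2⟩
    refine hσ (Finset.mem_filter.2 ⟨Fintype.mem_piFinset.2 fun i => ?_, ?_⟩)
    · exact Finset.mem_filter.2 ⟨Finset.mem_univ _, h2 i trivial⟩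
    · simp only [wordEvent, Set.mem_iInter]
      exact fun s _ => h1 s trivial

variable {Ω : Type*} [MeasurableSpace Ω] {P : Measure Ω}
  {ξ : (s : S) → WordConfig κ s → Ω → ℝ} {U : S → Set ℝ} {V : Fin n → Set ℝ} {q : S → ℝ≥0∞}

theorem measure_empiricalMeasure_ne_zero_le
    (hi : iIndepFun (fun r : (s : S) × WordConfig κ s => ξ r.1 r.2) P)
    (hU : ∀ s, MeasurableSet (U s)) (hq : ∀ s c, P (ξ s c ⁻¹' U s) = q s)
    (hV : ∀ i, MeasurableSet (V i)) (A : Finset (Fin n)) :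
    P {ω | empiricalMeasure S N κ (fun s c => ξ s c ω) (box U V) ≠ 0} ≤
      (∏ i ∈ A, 2 ^ κ i * blockLaw N (κ i) (V i)) * ∏ s ∈ wordsIn S A, q s := by
  classical
  have h := measure_exists_wordEvent_le hi hU hq (goodBlocks N κ V) A
  rw [subCount] at h
  simp_rw [card_goodBlocks hV] at h
  refine (measure_mono fun ω hω => ?_).trans h
  rw [Set.mem_ofPred_eq, empiricalMeasure_box ξ ω hU hV] at hω
  have h1 := right_ne_zero_of_mul hω
  obtain ⟨σ, hσ⟩ := Finset.card_pos.1 (Nat.pos_of_ne_zero (by exact_mod_cast h1))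
  exact ⟨σ, (Finset.mem_filter.1 hσ).1, (Finset.mem_filter.1 hσ).2⟩

/-- Markov's inequality: the expected mass of the box is the product on the right. -/
theorem measure_le_empiricalMeasure_le [IsProbabilityMeasure P]
    (hm : ∀ s c, Measurable (ξ s c))
    (hi : iIndepFun (fun r : (s : S) × WordConfig κ s => ξ r.1 r.2) P)
    (hU : ∀ s, MeasurableSet (U s)) (hq : ∀ s c, P (ξ s c ⁻¹' U s) = q s)
    (hV : ∀ i, MeasurableSet (V i)) {C : ℝ≥0∞} (hC0 : C ≠ 0) (hCt : C ≠ ⊤) :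
    P {ω | C ≤ empiricalMeasure S N κ (fun s c => ξ s c ω) (box U V)} ≤
      ((∏ s, q s) * ∏ i, blockLaw N (κ i) (V i)) * C⁻¹ := by
  classical
  have hc0 : (Fintype.card (Config κ) : ℝ≥0∞) ≠ 0 := by
    exact_mod_cast Fintype.card_ne_zero
  have hct : (Fintype.card (Config κ) : ℝ≥0∞) ≠ ⊤ := ENNReal.natCast_ne_top _
  have hmeas : Measurable fun ω => ((((Fintype.piFinset (goodBlocks N κ V)).filter
      fun σ => ω ∈ wordEvent ξ U Finset.univ σ).card : ℕ) : ℝ≥0∞) := by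
    simp_rw [Finset.card_filter, Nat.cast_sum]
    refine Finset.measurable_sum _ fun σ _ => ?_
    refine measurable_from_top.comp (Measurable.ite ?_ measurable_const measurable_const)
    exact measurableSet_wordEvent hm hU Finset.univ σ
  have h : ∫⁻ ω, empiricalMeasure S N κ (fun s c => ξ s c ω) (box U V) ∂P =
      (∏ s, q s) * ∏ i, blockLaw N (κ i) (V i) := by
    simp_rw [empiricalMeasure_box ξ _ hU hV]
    rw [lintegral_const_mul _ hmeas, lintegral_count_wordEvent hm hi hU hq,
      card_piFinset_goodBlocks hV, ← mul_assoc, ← mul_assoc, ENNReal.inv_mul_cancel hc0 hct,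
      one_mul, mul_comm]
  rw [← div_eq_mul_inv, ← h]
  refine meas_ge_le_lintegral_div ?_ hC0 hCt
  simp_rw [empiricalMeasure_box ξ _ hU hV]
  exact (hmeas.const_mul _).aemeasurable

theorem measure_two_mul_empiricalMeasure_lt_le [IsProbabilityMeasure P]
    (hS : ∀ s ∈ S, s ≠ [])
    (hm : ∀ s c, Measurable (ξ s c))
    (hi : iIndepFun (fun r : (s : S) × WordConfig κ s => ξ r.1 r.2) P)
    (hU : ∀ s, MeasurableSet (U s)) (hq : ∀ s c, P (ξ s c ⁻¹' U s) = q s)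
    (hV : ∀ i, MeasurableSet (V i)) (hq0 : ∀ s, q s ≠ 0) (hqt : ∀ s, q s ≠ ⊤)
    (hQ : ∀ i, blockLaw N (κ i) (V i) ≠ 0) :
    P {ω | 2 * empiricalMeasure S N κ (fun s c => ξ s c ω) (box U V) <
        (∏ s, q s) * ∏ i, blockLaw N (κ i) (V i)} ≤
      4 * ∑ B ∈ Finset.univ.erase (∅ : Finset (Fin n)),
        ((∏ i ∈ B, 2 ^ κ i * blockLaw N (κ i) (V i)) * ∏ s ∈ wordsIn S B, q s)⁻¹ := by
  classical
  have hc0 : (Fintype.card (Config κ) : ℝ≥0∞) ≠ 0 := by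
    exact_mod_cast Fintype.card_ne_zero
  have hct : (Fintype.card (Config κ) : ℝ≥0∞) ≠ ⊤ := ENNReal.natCast_ne_top _
  have hG : ∀ i, (goodBlocks N κ V i).Nonempty := by
    intro i
    rw [← Finset.card_pos, Nat.pos_iff_ne_zero, ← Nat.cast_ne_zero (R := ℝ≥0∞),
      card_goodBlocks hV]
    exact mul_ne_zero (by simp) (hQ i)
  have hsum := sum_measure_wordEvent_inter_le hS hi hU hq hq0 hqt (goodBlocks N κ V) hG
  simp_rw [subCount, card_goodBlocks hV] at hsum
  have hF0 : ((Fintype.piFinset (goodBlocks N κ V)).card : ℝ≥0∞) * ∏ s, q s ≠ 0 := by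
    rw [card_piFinset_goodBlocks hV]
    exact mul_ne_zero (mul_ne_zero hc0 (Finset.prod_ne_zero_iff.2 fun i _ => hQ i))
      (Finset.prod_ne_zero_iff.2 fun s _ => hq0 s)
  refine le_trans (measure_mono fun ω hω => ?_) (measure_two_mul_count_lt_le P
    (Fintype.piFinset (goodBlocks N κ V)) (E := wordEvent ξ U Finset.univ)
    (fun σ => measurableSet_wordEvent hm hU _ σ) (fun σ _ => measure_wordEvent hi hU hq _ σ)
    hF0 (ENNReal.prod_ne_top fun s _ => hqt s) hsum)
  rw [Set.mem_ofPred_eq, empiricalMeasure_box ξ ω hU hV] at hω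
  rw [Set.mem_ofPred_eq, card_piFinset_goodBlocks hV, mul_assoc]
  have h1 := (ENNReal.mul_lt_mul_iff_right hc0 hct).2 hω
  rw [mul_left_comm, ← mul_assoc _ _⁻¹, ENNReal.mul_inv_cancel hc0 hct, one_mul,
    mul_comm (∏ s, q s)] at h1
  convert h1

end Box

/-! ### Almost sure local large deviations -/

/-- The first Borel–Cantelli lemma, after emptying the finitely many sets for which the bound is not
known. -/
theorem ae_eventually_notMem_of_le_expScale {Ω : Type*} [MeasurableSpace Ω] {P : Measure Ω}
    {s : ℕ → Set Ω} {b : ℝ} (hb : 0 < b) {C : ℝ≥0∞} (hC : C ≠ ⊤)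
    (h : ∀ᶠ N in atTop, P (s N) ≤ C * expScale b N) :
    ∀ᵐ ω ∂P, ∀ᶠ N in atTop, ω ∉ s N := by
  obtain ⟨N₀, hN₀⟩ := eventually_atTop.1 h
  have hle : ∀ N, P (if N₀ ≤ N then s N else ∅) ≤ C * expScale b N := by
    intro N
    split_ifs with hN
    · exact hN₀ N hN
    · simp
  have hsum : ∑' N, P (if N₀ ≤ N then s N else ∅) ≠ ⊤ := by
    refine ne_top_of_le_ne_top ?_ (ENNReal.tsum_le_tsum hle)
    rw [ENNReal.tsum_mul_left]
    exact ENNReal.mul_ne_top hC (tsum_expScale_ne_top hb)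
  filter_upwards [ae_eventually_notMem hsum] with ω hω
  filter_upwards [hω, eventually_ge_atTop N₀] with N h1 h2
  simpa [h2] using h1

/-- The estimates are only known almost surely for each fixed set and exponent. Restricting to basic
open sets and rational exponents leaves countably many statements, and monotonicity in both
arguments recovers the rest. -/
theorem ae_localLDP {Ω X : Type*} [MeasurableSpace Ω] {P : Measure Ω} [TopologicalSpace X]
    [SecondCountableTopology X] [MeasurableSpace X] {μ : Ω → ℕ → Measure X} {I : X → ℝ≥0∞}
    (hlsc : LowerSemicontinuous I)
    (hupper : ∀ x, ∀ a : ℝ, (a : EReal) < I x →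
      ∃ U, IsOpen U ∧ x ∈ U ∧ ∀ᵐ ω ∂P, ∀ᶠ N in atTop, μ ω N U ≤ expScale a N)
    (hlower : ∀ x, ∀ a : ℝ, (I x : EReal) < a → ∀ U, IsOpen U → x ∈ U →
      ∀ᵐ ω ∂P, ∀ᶠ N in atTop, expScale a N ≤ μ ω N U)
    (htight : ∀ a : ℝ, ∃ K, IsCompact K ∧ ∀ᵐ ω ∂P, ∀ᶠ N in atTop, μ ω N Kᶜ ≤ expScale a N) :
    ∀ᵐ ω ∂P, LocalLDP (μ ω) I := by
  have hb := TopologicalSpace.isBasis_countableBasis X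
  have hcount : Countable (TopologicalSpace.countableBasis X) :=
    (TopologicalSpace.countable_countableBasis X).to_subtype
  choose K hK hKN using htight
  -- Each implication is almost surely true: its premise does not depend on `ω`, so it either
  -- supplies the conclusion almost surely or makes the implication vacuous.
  have h1 : ∀ᵐ ω ∂P, ∀ U : TopologicalSpace.countableBasis X, ∀ a : ℚ,
      (∀ᵐ ω' ∂P, ∀ᶠ N in atTop, μ ω' N U ≤ expScale a N) →
        ∀ᶠ N in atTop, μ ω N U ≤ expScale a N :=
    ae_all_iff.2 fun U => ae_all_iff.2 fun a => by
      by_cases h : ∀ᵐ ω' ∂P, ∀ᶠ N in atTop, μ ω' N U ≤ expScale a N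
      · filter_upwards [h] with ω hω _ using hω
      · exact ae_of_all _ fun _ h' => absurd h' h
  have h2 : ∀ᵐ ω ∂P, ∀ U : TopologicalSpace.countableBasis X, ∀ a : ℚ,
      (∀ᵐ ω' ∂P, ∀ᶠ N in atTop, expScale a N ≤ μ ω' N U) →
        ∀ᶠ N in atTop, expScale a N ≤ μ ω N U :=
    ae_all_iff.2 fun U => ae_all_iff.2 fun a => by
      by_cases h : ∀ᵐ ω' ∂P, ∀ᶠ N in atTop, expScale a N ≤ μ ω' N U
      · filter_upwards [h] with ω hω _ using hω
      · exact ae_of_all _ fun _ h' => absurd h' h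
  have h3 : ∀ᵐ ω ∂P, ∀ a : ℚ, ∀ᶠ N in atTop, μ ω N (K a)ᶜ ≤ expScale a N :=
    ae_all_iff.2 fun a => hKN a
  filter_upwards [h1, h2, h3] with ω h1 h2 h3
  refine ⟨hlsc, fun x a ha => ?_, fun x a ha U hU hxU => ?_, fun a => ?_⟩
  · obtain ⟨b, hab, hbI⟩ := EReal.lt_iff_exists_rat_btwn.1 ha
    have hab' : a < b := by exact_mod_cast hab
    obtain ⟨U, hU, hxU, hUN⟩ := hupper x b hbI
    obtain ⟨V, hV, hxV, hVU⟩ := hb.exists_subset_of_mem_open hxU hU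
    refine ⟨V, hb.isOpen hV, hxV, ?_⟩
    have := h1 ⟨V, hV⟩ b (by
      filter_upwards [hUN] with ω' hω'
      filter_upwards [hω'] with N hN using (measure_mono hVU).trans hN)
    filter_upwards [this] with N hN using hN.trans (expScale_anti hab'.le N)
  · obtain ⟨b, hIb, hba⟩ := EReal.lt_iff_exists_rat_btwn.1 ha
    have hba' : (b : ℝ) < a := by exact_mod_cast hba
    obtain ⟨V, hV, hxV, hVU⟩ := hb.exists_subset_of_mem_open hxU hU
    filter_upwards [h2 ⟨V, hV⟩ b (hlower x b hIb V (hb.isOpen hV) hxV)] with N hN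
    exact (expScale_anti hba'.le N).trans (hN.trans (measure_mono hVU))
  · obtain ⟨b, hab⟩ := exists_rat_gt a
    exact ⟨K b, hK b, (h3 b).mono fun N hN => hN.trans (expScale_anti hab.le N)⟩

/-! ### Sums of extended reals -/

theorem exists_lt_of_lt_add {x y : ℝ≥0∞} {r : ℝ} (h : (r : EReal) < (x + y : ℝ≥0∞)) :
    ∃ a b : ℝ, (a : EReal) < x ∧ (b : EReal) < y ∧ r < a + b := by
  rw [EReal.coe_ennreal_add] at h
  by_contra! hcon
  refine h.not_ge (EReal.add_le_of_forall_lt fun a' ha' b' hb' => ?_)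
  induction a' with
  | bot => simp
  | top => exact absurd ha' not_top_lt
  | coe a =>
    induction b' with
    | bot => simp
    | top => exact absurd hb' not_top_lt
    | coe b => exact_mod_cast hcon a b ha' hb'

theorem exists_lt_of_lt_sum {ι : Type*} (s : Finset ι) (f : ι → ℝ≥0∞) {r : ℝ}
    (h : (r : EReal) < (∑ i ∈ s, f i : ℝ≥0∞)) :
    ∃ a : ι → ℝ, (∀ i, (a i : EReal) < f i) ∧ r < ∑ i ∈ s, a i := by
  classical
  induction s using Finset.induction_on generalizing r with
  | empty =>
    -- A negative value is needed because the inequality is strict and `f i` may be `0`.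
    refine ⟨fun _ => -1, fun i => ?_, ?_⟩
    · refine lt_of_lt_of_le ?_ (EReal.coe_ennreal_nonneg _)
      exact EReal.coe_lt_coe_iff.2 (by norm_num : (-1 : ℝ) < 0)
    · simpa using h
  | insert i s hi ih =>
    rw [Finset.sum_insert hi] at h
    obtain ⟨b, c, hb, hc, hr⟩ := exists_lt_of_lt_add h
    obtain ⟨a, ha, hca⟩ := ih hc
    refine ⟨Function.update a i b, fun j => ?_, ?_⟩
    · by_cases hj : j = i
      · subst hj; simpa using hb
      · simpa [hj] using ha j
    · rw [Finset.sum_insert hi, Function.update_self, Finset.sum_congr rfl fun j hj =>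
        Function.update_of_ne (ne_of_mem_of_not_mem hj hi) _ _]
      linarith

theorem eventually_two_pow_le {k : ℕ → ℕ} {p a : ℝ}
    (hk : Tendsto (fun N : ℕ => (k N : ℝ) / N) atTop (𝓝 p)) (ha : a < -(p * Real.log 2)) :
    ∀ᶠ N in atTop, (2 : ℝ≥0∞) ^ k N ≤ expScale a N := by
  filter_upwards [eventually_expScale_le_expScale hk (a := a) (b := -Real.log 2)
    (by linarith)] with N hN
  refine Eq.trans_le ?_ hN
  rw [expScale, mul_neg, neg_neg, Real.exp_nat_mul, Real.exp_log two_pos,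
    ENNReal.ofReal_pow zero_le_two]
  simp

theorem eventually_le_two_pow {k : ℕ → ℕ} {p a : ℝ}
    (hk : Tendsto (fun N : ℕ => (k N : ℝ) / N) atTop (𝓝 p)) (ha : -(p * Real.log 2) < a) :
    ∀ᶠ N in atTop, expScale a N ≤ (2 : ℝ≥0∞) ^ k N := by
  filter_upwards [eventually_expScale_ge_expScale hk (a := a) (b := -Real.log 2)
    (by linarith)] with N hN
  refine hN.trans_eq ?_
  rw [expScale, mul_neg, neg_neg, Real.exp_nat_mul, Real.exp_log two_pos,
    ENNReal.ofReal_pow zero_le_two]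
  simp

/-! ### Almost sure bounds for boxes -/

section Field

variable {n : ℕ} {S : Finset (List (Fin n))} {k : ℕ → Fin n → ℕ} {Ω : Type*} [MeasurableSpace Ω]

/-- For all large `N`, the variables `ξ N s c` are independent, and the law of `ξ N s c` is
`ν s N`. -/
structure IsWordField (P : Measure Ω) (ν : S → ℕ → Measure ℝ)
    (ξ : (N : ℕ) → (s : S) → WordConfig (k N) s → Ω → ℝ) : Prop where
  measurable : ∀ᶠ N in atTop, ∀ s c, Measurable (ξ N s c)
  law : ∀ᶠ N in atTop, ∀ s c, P.map (ξ N s c) = ν s N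
  indep : ∀ᶠ N in atTop, iIndepFun (fun r : (s : S) × WordConfig (k N) s => ξ N r.1 r.2) P

variable {P : Measure Ω} {ν : S → ℕ → Measure ℝ}
  {ξ : (N : ℕ) → (s : S) → WordConfig (k N) s → Ω → ℝ}
  {U : S → Set ℝ} {V : Fin n → Set ℝ}

theorem ae_eventually_empiricalMeasure_eq_zero (hξ : IsWordField P ν ξ)
    (hU : ∀ s, MeasurableSet (U s)) (hV : ∀ i, MeasurableSet (V i)) (A : Finset (Fin n)) {b : ℝ}
    (hb : 0 < b)
    (h : ∀ᶠ N in atTop, (∏ i ∈ A, 2 ^ k N i * blockLaw N (k N i) (V i)) *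
      ∏ s ∈ wordsIn S A, ν s N (U s) ≤ expScale b N) :
    ∀ᵐ ω ∂P, ∀ᶠ N in atTop,
      empiricalMeasure S N (k N) (fun s c => ξ N s c ω) (box U V) = 0 := by
  have := ae_eventually_notMem_of_le_expScale (P := P)
    (s := fun N => {ω | empiricalMeasure S N (k N) (fun s c => ξ N s c ω) (box U V) ≠ 0})
    hb ENNReal.one_ne_top (by
      filter_upwards [hξ.measurable, hξ.law, hξ.indep, h] with N hm hl hi hN
      rw [one_mul]
      refine (measure_empiricalMeasure_ne_zero_le hi hU (fun s c => ?_) hV A).trans hN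
      rw [← hl s c, Measure.map_apply (hm s c) (hU s)])
  filter_upwards [this] with ω hω
  filter_upwards [hω] with N hN
  simpa using hN

theorem ae_eventually_empiricalMeasure_le [IsProbabilityMeasure P]
    (hξ : IsWordField P ν ξ)
    (hU : ∀ s, MeasurableSet (U s)) (hV : ∀ i, MeasurableSet (V i)) {a b : ℝ} (hab : a < b)
    (h : ∀ᶠ N in atTop, (∏ s, ν s N (U s)) * ∏ i, blockLaw N (k N i) (V i) ≤ expScale b N) :
    ∀ᵐ ω ∂P, ∀ᶠ N in atTop,
      empiricalMeasure S N (k N) (fun s c => ξ N s c ω) (box U V) ≤ expScale a N := by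
  have := ae_eventually_notMem_of_le_expScale (P := P)
    (s := fun N => {ω | expScale a N ≤
      empiricalMeasure S N (k N) (fun s c => ξ N s c ω) (box U V)})
    (sub_pos.2 hab) ENNReal.one_ne_top (by
      filter_upwards [hξ.measurable, hξ.law, hξ.indep, h] with N hm hl hi hN
      rw [one_mul]
      refine (measure_le_empiricalMeasure_le hm hi hU (q := fun s => ν s N (U s)) (fun s c => ?_) hV
        (expScale_pos _ _).ne' (expScale_ne_top _ _)).trans ?_
      · rw [← hl s c, Measure.map_apply (hm s c) (hU s)]
      · refine (mul_le_mul_left hN _).trans_eq ?_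
        rw [expScale_inv, expScale_mul, sub_eq_add_neg])
  filter_upwards [this] with ω hω
  filter_upwards [hω] with N hN
  exact (not_le.1 hN).le

theorem ae_eventually_le_empiricalMeasure [IsProbabilityMeasure P]
    (hS : ∀ s ∈ S, s ≠ []) (hξ : IsWordField P ν ξ)
    (hU : ∀ s, MeasurableSet (U s)) (hV : ∀ i, MeasurableSet (V i)) {a b : ℝ} (hab : b < a)
    (h : ∀ᶠ N in atTop, expScale b N ≤ (∏ s, ν s N (U s)) * ∏ i, blockLaw N (k N i) (V i))
    {e : ℝ} (he : 0 < e)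
    (hB : ∀ B : Finset (Fin n), B.Nonempty → ∀ᶠ N in atTop, expScale (-e) N ≤
      (∏ i ∈ B, 2 ^ k N i * blockLaw N (k N i) (V i)) * ∏ s ∈ wordsIn S B, ν s N (U s)) :
    ∀ᵐ ω ∂P, ∀ᶠ N in atTop,
      expScale a N ≤ empiricalMeasure S N (k N) (fun s c => ξ N s c ω) (box U V) := by
  have hB' : ∀ᶠ N in atTop, ∀ B : Finset (Fin n), B.Nonempty → expScale (-e) N ≤
      (∏ i ∈ B, 2 ^ k N i * blockLaw N (k N i) (V i)) * ∏ s ∈ wordsIn S B, ν s N (U s) :=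
    eventually_all.2 fun B => by
      by_cases h0 : B.Nonempty
      · filter_upwards [hB B h0] with N hN _ using hN
      · exact Eventually.of_forall fun N h' => absurd h' h0
  have := ae_eventually_notMem_of_le_expScale (P := P)
    (s := fun N => {ω | 2 * empiricalMeasure S N (k N) (fun s c => ξ N s c ω) (box U V) <
      (∏ s, ν s N (U s)) * ∏ i, blockLaw N (k N i) (V i)}) he
    (C := 4 * (Finset.univ.erase (∅ : Finset (Fin n))).card)
    (ENNReal.mul_ne_top (by simp) (ENNReal.natCast_ne_top _)) (by
      filter_upwards [hξ.measurable, hξ.law, hξ.indep, h, hB'] with N hm hl hi hN hBN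
      have hpos := ((expScale_pos b N).trans_le hN).ne'
      have hq : ∀ s c, P (ξ N s c ⁻¹' U s) = ν s N (U s) := fun s c => by
        rw [← hl s c, Measure.map_apply (hm s c) (hU s)]
      refine (measure_two_mul_empiricalMeasure_lt_le hS hm hi hU hq hV
        (fun s => Finset.prod_ne_zero_iff.1 (left_ne_zero_of_mul hpos) s (Finset.mem_univ s))
        (fun s => ?_)
        (fun i => Finset.prod_ne_zero_iff.1 (right_ne_zero_of_mul hpos) i
          (Finset.mem_univ i))).trans ?_
      · rw [← hq s fun _ _ => 1]
        exact measure_ne_top P _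
      · rw [mul_assoc]
        gcongr
        rw [← nsmul_eq_mul]
        refine Finset.sum_le_card_nsmul _ _ _ fun B hBmem => ?_
        rw [ENNReal.inv_le_iff_inv_le, expScale_inv]
        exact hBN B (Finset.nonempty_iff_ne_empty.2 (Finset.ne_of_mem_erase hBmem)))
  filter_upwards [this] with ω hω
  filter_upwards [hω, h, eventually_mul_expScale_le hab (C := 2) (by simp)] with N h1 h2 h3
  have h4 : 2 * expScale a N ≤
      2 * empiricalMeasure S N (k N) (fun s c => ξ N s c ω) (box U V) :=
    h3.trans (h2.trans (not_lt.1 h1))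
  exact (ENNReal.mul_le_mul_iff_right (by simp) (by simp)).1 h4

end Field

/-! ### The rate function -/

section Rate

variable {n : ℕ} {S : Finset (List (Fin n))} {p : Fin n → ℝ} {lam : S → Measure ℝ}

theorem sum_le_rate (z : (S → ℝ) × (Fin n → ℝ)) :
    (∑ s : S, cramerRate (lam s) (z.1 s)) + ∑ i, ENNReal.ofReal (p i) * spinRate (z.2 i / p i) ≤
      rate S p lam z := by
  rw [rate]
  split_ifs
  · exact le_rfl
  · exact le_top

theorem lowerSemicontinuous_wordRate (h_prob : ∀ s, IsProbabilityMeasure (lam s)) (s : S) :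
    LowerSemicontinuous fun z : (S → ℝ) × (Fin n → ℝ) => cramerRate (lam s) (z.1 s) :=
  (lowerSemicontinuous_cramerRate (lam s)).comp (by fun_prop)

theorem lowerSemicontinuous_blockRate (i : Fin n) :
    LowerSemicontinuous fun z : (S → ℝ) × (Fin n → ℝ) =>
      ENNReal.ofReal (p i) * spinRate (z.2 i / p i) := by
  refine (ENNReal.continuous_const_mul ENNReal.ofReal_ne_top).comp_lowerSemicontinuous ?_
    fun a b hab => ?_
  · rw [spinRate_eq_cramerRate]
    exact (lowerSemicontinuous_cramerRate spinLaw).comp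
      (g := fun z : (S → ℝ) × (Fin n → ℝ) => z.2 i / p i) (by fun_prop)
  · dsimp only
    gcongr

theorem isClosed_rateDomain (h_prob : ∀ s, IsProbabilityMeasure (lam s)) :
    IsClosed (rateDomain S p lam) := by
  have h : ∀ A : Finset (Fin n), LowerSemicontinuous fun z : (S → ℝ) × (Fin n → ℝ) =>
      (∑ s : S with s.1.toFinset ⊆ A, cramerRate (lam s) (z.1 s)) +
        ∑ i ∈ A, ENNReal.ofReal (p i) * spinRate (z.2 i / p i) := fun A =>
    (lowerSemicontinuous_sum fun s _ => lowerSemicontinuous_wordRate h_prob s).add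
      (lowerSemicontinuous_sum fun i _ => lowerSemicontinuous_blockRate i)
  rw [rateDomain, Set.ofPred_forall]
  exact isClosed_iInter fun A => (h A).isClosed_preimage _

/-- A lower semicontinuous sum stays lower semicontinuous when set to `∞` off a closed set. -/
theorem lowerSemicontinuous_rate (h_prob : ∀ s, IsProbabilityMeasure (lam s)) :
    LowerSemicontinuous (rate S p lam) := by
  intro z b hb
  by_cases hz : z ∈ rateDomain S p lam
  · rw [rate, if_pos hz] at hb
    have h : LowerSemicontinuous fun z : (S → ℝ) × (Fin n → ℝ) =>
        (∑ s : S, cramerRate (lam s) (z.1 s)) +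
          ∑ i, ENNReal.ofReal (p i) * spinRate (z.2 i / p i) :=
      (lowerSemicontinuous_sum fun s _ => lowerSemicontinuous_wordRate h_prob s).add
        (lowerSemicontinuous_sum fun i _ => lowerSemicontinuous_blockRate i)
    filter_upwards [h z b hb] with y hy using lt_of_lt_of_le hy (sum_le_rate y)
  · filter_upwards [(isClosed_rateDomain h_prob).isOpen_compl.mem_nhds hz] with y hy
    rw [rate, if_neg hz] at hb
    rwa [rate, if_neg hy]

end Rate

/-! ### Almost sure local large deviations for the empirical measures -/

section Main

variable {n : ℕ} {S : Finset (List (Fin n))} {k : ℕ → Fin n → ℕ} {p : Fin n → ℝ}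
  {lam : S → Measure ℝ} {Ω : Type*} [MeasurableSpace Ω] {P : Measure Ω} [IsProbabilityMeasure P]
  {ξ : (N : ℕ) → (s : S) → WordConfig (k N) s → Ω → ℝ}

instance isProbabilityMeasure_sampleMeanLaw (ν : Measure ℝ) [IsProbabilityMeasure ν] (N : ℕ) :
    IsProbabilityMeasure (sampleMeanLaw ν N) :=
  Measure.isProbabilityMeasure_map (by fun_prop)

instance isProbabilityMeasure_blockLaw (N k : ℕ) : IsProbabilityMeasure (blockLaw N k) :=
  Measure.isProbabilityMeasure_map (by fun_prop)

/-- Inside the domain the expected mass decides. Outside it, a violated constraint for some `A`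
makes a small box around `z` empty of configurations for all large `N`, whatever `a` is. -/
theorem empirical_upper (hp : ∀ i, 0 < p i)
    (hk_lim : ∀ i, Tendsto (fun N : ℕ => (k N i : ℝ) / N) atTop (𝓝 (p i)))
    (h_prob : ∀ s, IsProbabilityMeasure (lam s))
    (h_exp : ∀ s, (0 : ℝ) ∈ interior {ρ : ℝ | logMGF (lam s) ρ < ⊤})
    (hξ : IsWordField P (fun s => sampleMeanLaw (lam s)) ξ)
    (z : (S → ℝ) × (Fin n → ℝ)) (a : ℝ) (ha : (a : EReal) < rate S p lam z) :
    ∃ W, IsOpen W ∧ z ∈ W ∧ ∀ᵐ ω ∂P, ∀ᶠ N in atTop,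
      empiricalMeasure S N (k N) (fun s c => ξ N s c ω) W ≤ expScale a N := by
  have hopen : ∀ (c : S → ℝ) (b : Fin n → ℝ),
      (∀ s, (c s : EReal) < cramerRate (lam s) (z.1 s)) →
      (∀ i, (b i : EReal) < (ENNReal.ofReal (p i) * spinRate (z.2 i / p i) : ℝ≥0∞)) →
      ∃ (U : S → Set ℝ) (V : Fin n → Set ℝ), (∀ s, IsOpen (U s)) ∧ (∀ i, IsOpen (V i)) ∧
        z ∈ box U V ∧
        (∀ᶠ N in atTop, ∀ s, sampleMeanLaw (lam s) N (U s) ≤ expScale (c s) N) ∧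
        (∀ᶠ N in atTop, ∀ i, blockLaw N (k N i) (V i) ≤ expScale (b i) N) := by
    intro c b hc hb
    choose U hU hzU hUN using fun s =>
      (localLDP_sampleMeanLaw (lam s) (h_exp s)).upper (z.1 s) (c s) (hc s)
    choose V hV hzV hVN using fun i =>
      (localLDP_blockLaw (hp i) (hk_lim i)).upper (z.2 i) (b i) (hb i)
    exact ⟨U, V, hU, hV, ⟨fun s _ => hzU s, fun i _ => hzV i⟩, eventually_all.2 hUN,
      eventually_all.2 hVN⟩
  by_cases hz : z ∈ rateDomain S p lam
  · rw [rate, if_pos hz] at ha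
    obtain ⟨c', b', hc', hb', hcb⟩ := exists_lt_of_lt_add ha
    obtain ⟨c, hc, hcc⟩ := exists_lt_of_lt_sum _ _ hc'
    obtain ⟨b, hb, hbb⟩ := exists_lt_of_lt_sum _ _ hb'
    obtain ⟨U, V, hU, hV, hzUV, hUN, hVN⟩ := hopen c b hc hb
    refine ⟨box U V, (isOpen_set_pi Set.finite_univ fun s _ => hU s).prod
      (isOpen_set_pi Set.finite_univ fun i _ => hV i), hzUV, ?_⟩
    refine ae_eventually_empiricalMeasure_le hξ (fun s => (hU s).measurableSet)
      (fun i => (hV i).measurableSet) (b := ∑ s, c s + ∑ i, b i) (by linarith) ?_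
    filter_upwards [hUN, hVN] with N h1 h2
    rw [← expScale_mul, ← prod_expScale, ← prod_expScale]
    exact mul_le_mul' (Finset.prod_le_prod' fun s _ => h1 s) (Finset.prod_le_prod' fun i _ => h2 i)
  · obtain ⟨A, hA⟩ := not_forall.1 hz
    rw [not_le] at hA
    have hlog : 0 < Real.log 2 := Real.log_pos one_lt_two
    have hA' := EReal.coe_ennreal_lt_coe_ennreal_iff.2 hA
    rw [EReal.coe_ennreal_ofReal, max_eq_left
      (Finset.sum_nonneg fun i _ => (mul_pos (hp i) hlog).le)] at hA'
    obtain ⟨c', b', hc', hb', hcb⟩ := exists_lt_of_lt_add hA'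
    obtain ⟨c, hc, hcc⟩ := exists_lt_of_lt_sum _ _ hc'
    obtain ⟨b, hb, hbb⟩ := exists_lt_of_lt_sum _ _ hb'
    obtain ⟨U, V, hU, hV, hzUV, hUN, hVN⟩ := hopen c b hc hb
    refine ⟨box U V, (isOpen_set_pi Set.finite_univ fun s _ => hU s).prod
      (isOpen_set_pi Set.finite_univ fun i _ => hV i), hzUV, ?_⟩
    set δ := ∑ s ∈ wordsIn S A, c s + ∑ i ∈ A, b i - ∑ i ∈ A, p i * Real.log 2 with hδ
    have hδ0 : 0 < δ := by
      have : ∑ s ∈ wordsIn S A, c s = ∑ s : S with s.1.toFinset ⊆ A, c s := rfl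
      linarith
    -- Replacing `2 ^ k N i` by its exponential rate costs `ε` for each block of `A`, in total at
    -- most half of the excess `δ`.
    set ε := δ / (2 * (A.card + 1)) with hε
    have hε0 : 0 < ε := by positivity
    have hAε : A.card * ε ≤ δ / 2 := by
      have : ε * (2 * (A.card + 1)) = δ := div_mul_cancel₀ _ (by positivity)
      linarith
    have hpow : ∀ᶠ N in atTop, ∀ i, (2 : ℝ≥0∞) ^ k N i ≤ expScale (-(p i * Real.log 2) - ε) N :=
      eventually_all.2 fun i => eventually_two_pow_le (hk_lim i) (by linarith)
    have hzero := ae_eventually_empiricalMeasure_eq_zero hξ (fun s => (hU s).measurableSet)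
      (fun i => (hV i).measurableSet) A (half_pos hδ0) (by
        filter_upwards [hUN, hVN, hpow] with N h1 h2 h3
        calc (∏ i ∈ A, 2 ^ k N i * blockLaw N (k N i) (V i)) *
              ∏ s ∈ wordsIn S A, sampleMeanLaw (lam s) N (U s)
            ≤ (∏ i ∈ A, expScale (-(p i * Real.log 2) - ε + b i) N) *
              ∏ s ∈ wordsIn S A, expScale (c s) N := by
              refine mul_le_mul' (Finset.prod_le_prod' fun i _ => ?_)
                (Finset.prod_le_prod' fun s _ => h1 s)
              rw [← expScale_mul]
              exact mul_le_mul' (h3 i) (h2 i)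
          _ ≤ expScale (δ / 2) N := by
              rw [prod_expScale, prod_expScale, expScale_mul]
              refine expScale_anti ?_ N
              rw [Finset.sum_add_distrib, Finset.sum_sub_distrib, Finset.sum_neg_distrib,
                Finset.sum_const, nsmul_eq_mul]
              linarith)
    filter_upwards [hzero] with ω hω
    filter_upwards [hω] with N hN
    rw [hN]
    exact zero_le

theorem empirical_lower (hS : ∀ s ∈ S, s ≠ []) (hp : ∀ i, 0 < p i)
    (hk_lim : ∀ i, Tendsto (fun N : ℕ => (k N i : ℝ) / N) atTop (𝓝 (p i)))
    (h_prob : ∀ s, IsProbabilityMeasure (lam s))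
    (h_exp : ∀ s, (0 : ℝ) ∈ interior {ρ : ℝ | logMGF (lam s) ρ < ⊤})
    (hξ : IsWordField P (fun s => sampleMeanLaw (lam s)) ξ)
    (z : (S → ℝ) × (Fin n → ℝ)) (a : ℝ) (ha : (rate S p lam z : EReal) < a)
    (W : Set ((S → ℝ) × (Fin n → ℝ))) (hW : IsOpen W) (hzW : z ∈ W) :
    ∀ᵐ ω ∂P, ∀ᶠ N in atTop,
      expScale a N ≤ empiricalMeasure S N (k N) (fun s c => ξ N s c ω) W := by
  have hlog : 0 < Real.log 2 := Real.log_pos one_lt_two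
  have hz : z ∈ rateDomain S p lam := by
    by_contra h
    rw [rate, if_neg h] at ha
    simp at ha
  rw [rate, if_pos hz] at ha
  choose m hm using fun s => exists_cramerRate_contract (lam s) (h_exp s)
  choose m' hm' using fun i => exists_spinRate_contract (hp i)
  -- This is the segment from the means to `z`. A point with `t < 1` close to `1` is still in `W`,
  -- has no larger total rate, and satisfies every constraint with nonempty `A` strictly.
  set y : ℝ → (S → ℝ) × (Fin n → ℝ) := fun t =>
    (fun s => m s + t * (z.1 s - m s), fun i => m' i + t * (z.2 i - m' i)) with hy
  have hyc : Continuous y := by fun_prop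
  have hy1 : y 1 = z := by simp [hy]
  obtain ⟨t, htW, ht0, ht1⟩ : ∃ t, y t ∈ W ∧ 0 < t ∧ t < 1 := by
    have h1 : ∀ᶠ t in 𝓝[<] (1 : ℝ), y t ∈ W :=
      ((hyc.tendsto' 1 z hy1).eventually (hW.mem_nhds hzW)).filter_mono nhdsWithin_le_nhds
    have h2 : ∀ᶠ t in 𝓝[<] (1 : ℝ), t ∈ Set.Ioo 0 1 := Ioo_mem_nhdsLT one_pos
    obtain ⟨t, h3, h4⟩ := (h1.and h2).exists
    exact ⟨t, h3, h4.1, h4.2⟩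
  set F : S → ℝ≥0∞ := fun s => cramerRate (lam s) ((y t).1 s) with hF
  set G : Fin n → ℝ≥0∞ := fun i => ENNReal.ofReal (p i) * spinRate ((y t).2 i / p i) with hG
  have hscale : ∀ (B : Finset S) (A : Finset (Fin n)), ∑ s ∈ B, F s + ∑ i ∈ A, G i ≤
      ENNReal.ofReal t * (∑ s ∈ B, cramerRate (lam s) (z.1 s) +
        ∑ i ∈ A, ENNReal.ofReal (p i) * spinRate (z.2 i / p i)) := by
    intro B A
    rw [mul_add, Finset.mul_sum, Finset.mul_sum]
    exact add_le_add (Finset.sum_le_sum fun s _ => hm s _ t ht0.le ht1.le)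
      (Finset.sum_le_sum fun i _ => hm' i _ t ht0.le ht1.le)
  have hdom : ∀ A : Finset (Fin n), ∑ s ∈ wordsIn S A, F s + ∑ i ∈ A, G i ≤
      ENNReal.ofReal (t * ∑ i ∈ A, p i * Real.log 2) := by
    intro A
    rw [ENNReal.ofReal_mul ht0.le]
    exact (hscale _ _).trans (mul_le_mul_right (hz A) _)
  have huniv : wordsIn S Finset.univ = Finset.univ := by simp [wordsIn]
  have htop := ne_top_of_le_ne_top ENNReal.ofReal_ne_top (hdom Finset.univ)
  rw [huniv, ENNReal.add_ne_top, ENNReal.sum_ne_top, ENNReal.sum_ne_top] at htop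
  have hFt : ∀ s, F s ≠ ⊤ := fun s => htop.1 s (Finset.mem_univ s)
  have hGt : ∀ i, G i ≠ ⊤ := fun i => htop.2 i (Finset.mem_univ i)
  set f : S → ℝ := fun s => (F s).toReal with hf
  set g : Fin n → ℝ := fun i => (G i).toReal with hg
  have hreal : ∀ (B : Finset S) (A : Finset (Fin n)),
      ((∑ s ∈ B, F s + ∑ i ∈ A, G i : ℝ≥0∞) : EReal) =
        ((∑ s ∈ B, f s + ∑ i ∈ A, g i : ℝ) : EReal) := by
    intro B A
    have h1 : ∑ s ∈ B, F s ≠ ⊤ := ENNReal.sum_ne_top.2 fun s _ => hFt s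
    have h2 : ∑ i ∈ A, G i ≠ ⊤ := ENNReal.sum_ne_top.2 fun i _ => hGt i
    rw [← EReal.coe_ennreal_toReal (ENNReal.add_ne_top.2 ⟨h1, h2⟩), ENNReal.toReal_add h1 h2,
      ENNReal.toReal_sum fun s _ => hFt s, ENNReal.toReal_sum fun i _ => hGt i]
  have hdom' : ∀ A : Finset (Fin n), ∑ s ∈ wordsIn S A, f s + ∑ i ∈ A, g i ≤
      t * ∑ i ∈ A, p i * Real.log 2 := by
    intro A
    have h1 := EReal.coe_ennreal_le_coe_ennreal_iff.2 (hdom A)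
    rw [hreal, EReal.coe_ennreal_ofReal, max_eq_left (mul_nonneg ht0.le
      (Finset.sum_nonneg fun i _ => (mul_pos (hp i) hlog).le))] at h1
    exact_mod_cast h1
  have htot : ∑ s, f s + ∑ i, g i < a := by
    have h1 : ∑ s, F s + ∑ i, G i ≤ ∑ s, cramerRate (lam s) (z.1 s) +
        ∑ i, ENNReal.ofReal (p i) * spinRate (z.2 i / p i) := by
      refine (hscale _ _).trans ?_
      refine (mul_le_mul_left (ENNReal.ofReal_le_one.2 ht1.le) _).trans_eq (one_mul _)
    have h2 := (EReal.coe_ennreal_le_coe_ennreal_iff.2 h1).trans_lt ha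
    rw [hreal] at h2
    exact_mod_cast h2
  -- Both conditions are open in `ε` and hold at `ε = 0`; the second one because `hdom'` bounds its
  -- left side there by `(t - 1) * ∑ i ∈ B, p i * log 2 < 0`.
  obtain ⟨ε, hε1, hε2, hε0⟩ : ∃ ε : ℝ, ∑ s, (f s + ε) + ∑ i, (g i + ε) < a ∧
      (∀ B : Finset (Fin n), B.Nonempty →
        ∑ i ∈ B, (-(p i * Real.log 2) + ε + (g i + ε)) + ∑ s ∈ wordsIn S B, (f s + ε) + ε < 0) ∧
      0 < ε := by
    have h1 : ∀ᶠ ε in 𝓝[>] (0 : ℝ), ∑ s, (f s + ε) + ∑ i, (g i + ε) < a := by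
      have hc : Continuous fun ε : ℝ => ∑ s, (f s + ε) + ∑ i, (g i + ε) := by fun_prop
      refine (hc.continuousAt.eventually_lt_const ?_).filter_mono nhdsWithin_le_nhds
      simpa using htot
    have h2 : ∀ᶠ ε in 𝓝[>] (0 : ℝ), ∀ B : Finset (Fin n), B.Nonempty →
        ∑ i ∈ B, (-(p i * Real.log 2) + ε + (g i + ε)) + ∑ s ∈ wordsIn S B, (f s + ε) + ε < 0 := by
      refine eventually_all.2 fun B => ?_
      by_cases hB : B.Nonempty
      · have hc : Continuous fun ε : ℝ => ∑ i ∈ B, (-(p i * Real.log 2) + ε + (g i + ε)) +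
            ∑ s ∈ wordsIn S B, (f s + ε) + ε := by fun_prop
        have h0 : 0 < ∑ i ∈ B, p i * Real.log 2 :=
          Finset.sum_pos (fun i _ => mul_pos (hp i) hlog) hB
        have h3 : ∀ᶠ ε in 𝓝 (0 : ℝ), ∑ i ∈ B, (-(p i * Real.log 2) + ε + (g i + ε)) +
            ∑ s ∈ wordsIn S B, (f s + ε) + ε < 0 := by
          refine hc.continuousAt.eventually_lt_const ?_
          simp only [add_zero, Finset.sum_add_distrib, Finset.sum_neg_distrib]
          nlinarith [hdom' B]
        exact (h3.filter_mono nhdsWithin_le_nhds).mono fun ε h _ => h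
      · exact Eventually.of_forall fun ε h => absurd h hB
    obtain ⟨ε, h3, h4, h5⟩ := (h1.and (h2.and self_mem_nhdsWithin)).exists
    exact ⟨ε, h3, h4, h5⟩
  obtain ⟨r, hr, hball⟩ := Metric.isOpen_iff.1 hW _ htW
  set U : S → Set ℝ := fun s => Metric.ball ((y t).1 s) r
  set V : Fin n → Set ℝ := fun i => Metric.ball ((y t).2 i) r
  have hbox : box U V ⊆ W := by
    rintro x ⟨hx1, hx2⟩
    refine hball ?_
    rw [Metric.mem_ball, Prod.dist_eq, max_lt_iff, dist_pi_lt_iff hr, dist_pi_lt_iff hr]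
    exact ⟨fun s => hx1 s trivial, fun i => hx2 i trivial⟩
  have hUN : ∀ᶠ N in atTop, ∀ s, expScale (f s + ε) N ≤ sampleMeanLaw (lam s) N (U s) := by
    refine eventually_all.2 fun s => (localLDP_sampleMeanLaw (lam s) (h_exp s)).lower _ _ ?_ _
      Metric.isOpen_ball (Metric.mem_ball_self hr)
    change (F s : EReal) < _
    rw [← EReal.coe_ennreal_toReal (hFt s), EReal.coe_lt_coe_iff]
    exact lt_add_of_pos_right _ hε0
  have hVN : ∀ᶠ N in atTop, ∀ i, expScale (g i + ε) N ≤ blockLaw N (k N i) (V i) := by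
    refine eventually_all.2 fun i => (localLDP_blockLaw (hp i) (hk_lim i)).lower _ _ ?_ _
      Metric.isOpen_ball (Metric.mem_ball_self hr)
    change (G i : EReal) < _
    rw [← EReal.coe_ennreal_toReal (hGt i), EReal.coe_lt_coe_iff]
    exact lt_add_of_pos_right _ hε0
  have hpow : ∀ᶠ N in atTop, ∀ i, expScale (-(p i * Real.log 2) + ε) N ≤ (2 : ℝ≥0∞) ^ k N i :=
    eventually_all.2 fun i => eventually_le_two_pow (hk_lim i) (by linarith)
  have hmain := ae_eventually_le_empiricalMeasure hS hξ (U := U) (V := V)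
    (fun s => Metric.isOpen_ball.measurableSet) (fun i => Metric.isOpen_ball.measurableSet)
    hε1 (by
      filter_upwards [hUN, hVN] with N h1 h2
      rw [← expScale_mul, ← prod_expScale, ← prod_expScale]
      exact mul_le_mul' (Finset.prod_le_prod' fun s _ => h1 s)
        (Finset.prod_le_prod' fun i _ => h2 i)) hε0 (fun B hB => by
      filter_upwards [hUN, hVN, hpow] with N h1 h2 h3
      calc expScale (-ε) N ≤ (∏ i ∈ B, expScale (-(p i * Real.log 2) + ε + (g i + ε)) N) *
            ∏ s ∈ wordsIn S B, expScale (f s + ε) N := by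
            rw [prod_expScale, prod_expScale, expScale_mul]
            exact expScale_anti (by linarith [hε2 B hB]) N
        _ ≤ _ := by
            refine mul_le_mul' (Finset.prod_le_prod' fun i _ => ?_)
              (Finset.prod_le_prod' fun s _ => h1 s)
            rw [← expScale_mul]
            exact mul_le_mul' (h3 i) (h2 i))
  filter_upwards [hmain] with ω hω
  filter_upwards [hω] with N hN using hN.trans (measure_mono hbox)

theorem empirical_tight (hp : ∀ i, 0 < p i)
    (hk_lim : ∀ i, Tendsto (fun N : ℕ => (k N i : ℝ) / N) atTop (𝓝 (p i)))
    (h_prob : ∀ s, IsProbabilityMeasure (lam s))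
    (h_exp : ∀ s, (0 : ℝ) ∈ interior {ρ : ℝ | logMGF (lam s) ρ < ⊤})
    (hξ : IsWordField P (fun s => sampleMeanLaw (lam s)) ξ) (a : ℝ) :
    ∃ K, IsCompact K ∧ ∀ᵐ ω ∂P, ∀ᶠ N in atTop,
      empiricalMeasure S N (k N) (fun s c => ξ N s c ω) Kᶜ ≤ expScale a N := by
  -- Of the two spare units, one is spent on Markov's inequality with Borel–Cantelli, the other on
  -- the number `Fintype.card S + n` of coordinates.
  choose K hK hKN using fun s => (localLDP_sampleMeanLaw (lam s) (h_exp s)).tight (a + 2)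
  choose L hL hLN using fun i => (localLDP_blockLaw (hp i) (hk_lim i)).tight (a + 2)
  refine ⟨box K L, (isCompact_univ_pi hK).prod (isCompact_univ_pi hL), ?_⟩
  have h1 : ∀ᵐ ω ∂P, ∀ s, ∀ᶠ N in atTop, empiricalMeasure S N (k N) (fun s c => ξ N s c ω)
      (box (Function.update (fun _ => Set.univ) s (K s)ᶜ) fun _ => Set.univ) ≤
        expScale (a + 1) N := by
    refine ae_all_iff.2 fun s => ae_eventually_empiricalMeasure_le hξ (fun s' => ?_)
      (fun _ => .univ) (b := a + 2) (by linarith) ?_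
    · by_cases h : s' = s
      · subst h
        simpa using (hK s').measurableSet
      · simp [h]
    · filter_upwards [hKN s] with N hN
      rw [Finset.prod_eq_single s (fun s' _ h => by simp [h]) (by simp)]
      simpa using hN
  have h2 : ∀ᵐ ω ∂P, ∀ i, ∀ᶠ N in atTop, empiricalMeasure S N (k N) (fun s c => ξ N s c ω)
      (box (fun _ => Set.univ) (Function.update (fun _ => Set.univ) i (L i)ᶜ)) ≤
        expScale (a + 1) N := by
    refine ae_all_iff.2 fun i => ae_eventually_empiricalMeasure_le hξ (fun _ => .univ)
      (fun i' => ?_) (b := a + 2) (by linarith) ?_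
    · by_cases h : i' = i
      · subst h
        simpa using (hL i').measurableSet
      · simp [h]
    · filter_upwards [hLN i] with N hN
      rw [Finset.prod_eq_single i (fun i' _ h => by simp [h]) (by simp)]
      simpa using hN
  filter_upwards [h1, h2] with ω h1 h2
  filter_upwards [eventually_all.2 h1, eventually_all.2 h2,
    eventually_mul_expScale_le (lt_add_one a) (C := Fintype.card S + n) (by finiteness)]
    with N h1 h2 h3
  have hsub : (box K L)ᶜ ⊆
      (⋃ s, box (Function.update (fun _ => Set.univ) s (K s)ᶜ) fun _ => Set.univ) ∪
        ⋃ i, box (fun _ => Set.univ) (Function.update (fun _ => Set.univ) i (L i)ᶜ) := by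
    intro z hz
    by_contra hcon
    simp only [Set.mem_union, Set.mem_iUnion, not_or, not_exists] at hcon
    refine hz ⟨fun s _ => ?_, fun i _ => ?_⟩
    · by_contra hs
      refine hcon.1 s ⟨fun s' _ => ?_, fun _ _ => trivial⟩
      by_cases h : s' = s
      · subst h
        simpa using hs
      · simp [h]
    · by_contra hi
      refine hcon.2 i ⟨fun _ _ => trivial, fun i' _ => ?_⟩
      by_cases h : i' = i
      · subst h
        simpa using hi
      · simp [h]
  refine (measure_mono hsub).trans ((measure_union_le _ _).trans (le_trans ?_ h3))
  rw [add_mul]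
  refine add_le_add ?_ ?_
  · refine (measure_iUnion_fintype_le _ _).trans ((Finset.sum_le_card_nsmul _ _ _
      fun s _ => h1 s).trans_eq ?_)
    rw [nsmul_eq_mul, Finset.card_univ]
  · refine (measure_iUnion_fintype_le _ _).trans ((Finset.sum_le_card_nsmul _ _ _
      fun i _ => h2 i).trans_eq ?_)
    rw [nsmul_eq_mul, Finset.card_univ, Fintype.card_fin]

end Main

end

end WordGREM

theorem theorem4p3p3 {n : ℕ} (hn : 1 ≤ n)
    (S : Finset (List (Fin n))) (hS : ∀ s ∈ S, s ≠ [])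
    (k : ℕ → Fin n → ℕ) (hk_pos : ∀ N, n ≤ N → ∀ i, 1 ≤ k N i)
    (hk_sum : ∀ N, n ≤ N → ∑ i, k N i = N)
    (p : Fin n → ℝ) (hp : ∀ i, 0 < p i)
    (hk_lim : ∀ i, Tendsto (fun N : ℕ => (k N i : ℝ) / N) atTop (𝓝 (p i)))
    (lam : S → Measure ℝ) (h_prob : ∀ s, IsProbabilityMeasure (lam s))
    (h_exp : ∀ s, (0 : ℝ) ∈ interior {ρ : ℝ | WordGREM.logMGF (lam s) ρ < ⊤})
    {Ω : Type*} [MeasurableSpace Ω] (P : Measure Ω) [IsProbabilityMeasure P]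
    (ξ : (N : ℕ) → (s : S) → WordGREM.WordConfig (k N) s → Ω → ℝ)
    (h_meas : ∀ N, n ≤ N → ∀ s c, Measurable (ξ N s c))
    (h_law : ∀ N, n ≤ N → ∀ s c,
      P.map (ξ N s c) = WordGREM.sampleMeanLaw (lam s) N)
    (h_indep : ∀ N, n ≤ N →
      iIndepFun (fun q : (s : S) × WordGREM.WordConfig (k N) s => ξ N q.1 q.2) P) :
    ∀ᵐ ω ∂P, WordGREM.SatisfiesLDP
      (fun N => WordGREM.empiricalMeasure S N (k N) (fun s c => ξ N s c ω))
      (WordGREM.rate S p lam) := by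
  have hξ : WordGREM.IsWordField P (fun s => WordGREM.sampleMeanLaw (lam s)) ξ :=
    ⟨(eventually_ge_atTop n).mono h_meas, (eventually_ge_atTop n).mono h_law,
      (eventually_ge_atTop n).mono h_indep⟩
  filter_upwards [WordGREM.ae_localLDP (WordGREM.lowerSemicontinuous_rate h_prob)
    (WordGREM.empirical_upper hp hk_lim h_prob h_exp hξ)
    (WordGREM.empirical_lower hS hp hk_lim h_prob h_exp hξ)
    (WordGREM.empirical_tight hp hk_lim h_prob h_exp hξ)] with ω hω
  exact hω.satisfiesLDP
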